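/- Let $J\ge 1$ and let $\boldsymbol N_i=(N_{i1},\dots,N_{iJ})\sim\mathcal M(n_i,\boldsymbol\pi_i)$, $i=1,2$, be two independent multinomial samples with fixed sizes $n_1,n_2$; put $n=n_1+n_2$ and $\overline{\boldsymbol p}=\boldsymbol N/n$, where $\boldsymbol N=(\boldsymbol N_1,\boldsymbol N_2)$. The joint probabilities $p_{ij}=\frac{n_i}{n}\pi_{ij}>0$ are parametrized by the saturated loglinear model $$\log p_{ij}(\boldsymbol\theta)=u+u_{1(i)}+\theta_{2(j)}+\theta_{12(ij)},\qquad u_{1(2)}=\theta_{2(J)}=\theta_{12(1J)}=\theta_{12(2j)}=0,$$ with $\boldsymbol\theta=(\theta_{2(1)},\dots,\theta_{2(J-1)},\theta_{12(11)},\dots,\theta_{12(1,J-1)})^T\in\mathbb R^{2(J-1)}$, where $u=u(\boldsymbol\theta)$ and $u_{1(1)}=u_{1(1)}(\boldsymbol\theta)$ are determined by $\sum_j p_{ij}(\boldsymbol\theta)=n_i/n$, $i=1,2$. Let $\boldsymbol R=(\boldsymbol 0,\boldsymbol G_{J-1})$, where $\boldsymbol G_{J-1}$ is the $(J-1)\times(J-1)$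 matrix with $1$'s on the diagonal and $-1$'s on the first superdiagonal, and for $S\subseteq\{1,\dots,J-1\}$ let $\boldsymbol R(S)$ be the submatrix of the rows of $\boldsymbol R$ with index in $S$. Put $\ell(\boldsymbol N;\boldsymbol\theta)=\sum_{i,j}N_{ij}\log p_{ij}(\boldsymbol\theta)$, and let $\widehat{\boldsymbol\theta}$ and $\widehat{\boldsymbol\theta}(S)$ be maximum likelihood estimators over $\Theta_0=\{\boldsymbol\theta:\boldsymbol R\boldsymbol\theta=\boldsymbol 0\}$ and $\Theta(S)=\{\boldsymbol\theta:\boldsymbol R(S)\boldsymbol\theta=\boldsymbol 0\}$, that is, functions of $\boldsymbol N$ whose values maximize $\ell(\boldsymbol N;\cdot)$ over the respective set whenever a maximizer exists (and are arbitrary parameter values otherwise). Let $\phi:[0,\infty)\to\mathbb R$ be convex on $(0,\infty)$ and twice differentiable at $1$ with $\phi(1)=\phi'(1)=0$ and $\phi''(1)>0$, put $d_\phi(\boldsymbol p,\boldsymbol q)=\sum_{i,j}q_{ij}\phi(p_{ij}/q_{ij})$, and $$S_\phi(\boldsymbol p(\widehat{\boldsymbol\theta}(S)),\boldsymbol p(\widehat{\boldsymbol\theta}))=\frac{2n}{\phi''(1)}\,d_\phi(\boldsymbol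 p(\widehat{\boldsymbol\theta}(S)),\boldsymbol p(\widehat{\boldsymbol\theta})),$$ $$T_\phi(\overline{\boldsymbol p},\boldsymbol p(\widehat{\boldsymbol\theta}(S)),\boldsymbol p(\widehat{\boldsymbol\theta}))=\frac{2n}{\phi''(1)}\Bigl(d_\phi(\overline{\boldsymbol p},\boldsymbol p(\widehat{\boldsymbol\theta}))-d_\phi(\overline{\boldsymbol p},\boldsymbol p(\widehat{\boldsymbol\theta}(S)))\Bigr).$$ Suppose that $H_0$ holds, i.e. the true parameter $\boldsymbol\theta_0$ is a fixed vector with $\boldsymbol R\boldsymbol\theta_0=\boldsymbol 0$, and that $n_1,n_2\to\infty$ with $n_i/n\to\nu_i>0$, $i=1,2$. Then, for every $S\subseteq\{1,\dots,J-1\}$, $$S_\phi(\boldsymbol p(\widehat{\boldsymbol\theta}(S)),\boldsymbol p(\widehat{\boldsymbol\theta}))=T_\phi(\overline{\boldsymbol p},\boldsymbol p(\widehat{\boldsymbol\theta}(S)),\boldsymbol p(\widehat{\boldsymbol\theta}))+o_p(1),$$ and both statistics converge in distribution to a $\chi^2$ distribution with $J-1-\operatorname{card}(S)$ degrees of freedom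 ($\chi^2_0$ being the point mass at $0$). -/

import Mathlib

open MeasureTheory ProbabilityTheory Filter Topology

noncomputable section

namespace LoglinearTest

/-! Throughout, `J = K + 1` is the number of response categories, so `K = J - 1`.  A category is an
element of `Fin (K + 1)`, `Fin.last K` being the reference category, and a sample (a row of the
table) is an element of `Fin 2`: row `0` is the first sample, row `1` is the second one. -/

/-- The parameter `θ = (θ₂, θ₁₂)` of the saturated loglinear model, a vector of length `2 (J - 1)`:
`θ (Sum.inl j)` is `θ_{2(j)}` and `θ (Sum.inr j)` is `θ_{12(1j)}`. -/
abbrev Param (K : ℕ) : Type := Fin K ⊕ Fin K → ℝ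

/-- `θ_{2(j)}` for all `J` categories, with the identifiability restriction `θ_{2(J)} = 0`. -/
def theta2 {K : ℕ} (θ : Param K) (j : Fin (K + 1)) : ℝ :=
  Fin.snoc (α := fun _ => ℝ) (fun l : Fin K => θ (Sum.inl l)) 0 j

/-- `θ_{12(ij)}` for all cells, with the identifiability restrictions `θ_{12(1J)} = 0` and
`θ_{12(2j)} = 0`. -/
def theta12 {K : ℕ} (θ : Param K) (i : Fin 2) (j : Fin (K + 1)) : ℝ :=
  if i = 0 then Fin.snoc (α := fun _ => ℝ) (fun l : Fin K => θ (Sum.inr l)) 0 j else 0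

/-- The total sample size `n = n₁ + n₂`. -/
def total (n : Fin 2 → ℕ) : ℝ := (n 0 : ℝ) + (n 1 : ℝ)

/-- The redundant parameter `u(θ) = log n₂ - log n - log (1 + ∑_{j<J} exp θ_{2(j)})`. -/
def uParam {K : ℕ} (n : Fin 2 → ℕ) (θ : Param K) : ℝ :=
  Real.log (n 1) - Real.log (total n) - Real.log (1 + ∑ j : Fin K, Real.exp (θ (Sum.inl j)))

/-- The redundant parameter `u_{1(i)}(θ)`, with `u_{1(2)} = 0`. -/
def u1Param {K : ℕ} (n : Fin 2 → ℕ) (θ : Param K) (i : Fin 2) : ℝ :=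
  if i = 0 then
    Real.log ((n 0 : ℝ) / n 1) +
      Real.log ((1 + ∑ j : Fin K, Real.exp (θ (Sum.inl j))) /
        (1 + ∑ j : Fin K, Real.exp (θ (Sum.inl j) + θ (Sum.inr j))))
  else 0

/-- The joint cell probabilities `p_{ij}(θ)` of the saturated loglinear model
`log p_{ij} = u + u_{1(i)} + θ_{2(j)} + θ_{12(ij)}`, for sample sizes `n = (n₁, n₂)`. -/
def cellProb {K : ℕ} (n : Fin 2 → ℕ) (θ : Param K) (i : Fin 2) (j : Fin (K + 1)) : ℝ :=
  Real.exp (uParam n θ + u1Param n θ i + theta2 θ j + theta12 θ i j)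

/-- The conditional probabilities `π_{ij}(θ) = Pr(Y = j | X = i)`, which do not depend on the
sample sizes. -/
def condProb {K : ℕ} (θ : Param K) (i : Fin 2) (j : Fin (K + 1)) : ℝ :=
  Real.exp (theta2 θ j + theta12 θ i j) /
    ∑ l : Fin (K + 1), Real.exp (theta2 θ l + theta12 θ i l)

theorem cellProb_pos {K : ℕ} (n : Fin 2 → ℕ) (θ : Param K) (i : Fin 2) (j : Fin (K + 1)) :
    0 < cellProb n θ i j := Real.exp_pos _

theorem condProb_pos {K : ℕ} (θ : Param K) (i : Fin 2) (j : Fin (K + 1)) :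
    0 < condProb θ i j :=
  div_pos (Real.exp_pos _) (Finset.sum_pos (fun _ _ => Real.exp_pos _) Finset.univ_nonempty)

theorem sum_condProb {K : ℕ} (θ : Param K) (i : Fin 2) : ∑ j, condProb θ i j = 1 := by
  unfold condProb
  rw [← Finset.sum_div]
  exact div_self (Finset.sum_pos (fun _ _ => Real.exp_pos _) Finset.univ_nonempty).ne'

/-- The two descriptions of the model agree: `p_{ij}(θ) = (n_i / n) π_{ij}(θ)`. -/
theorem cellProb_eq {K : ℕ} (n : Fin 2 → ℕ) (hn : ∀ i, 0 < n i) (θ : Param K) (i : Fin 2)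
    (j : Fin (K + 1)) : cellProb n θ i j = (n i : ℝ) / total n * condProb θ i j := by
  have h0 : (0 : ℝ) < n 0 := by exact_mod_cast hn 0
  have h1 : (0 : ℝ) < n 1 := by exact_mod_cast hn 1
  have ht : 0 < total n := by unfold total; positivity
  have hA : (0 : ℝ) < 1 + ∑ j : Fin K, Real.exp (θ (Sum.inl j)) := by positivity
  have hB : (0 : ℝ) < 1 + ∑ j : Fin K, Real.exp (θ (Sum.inl j) + θ (Sum.inr j)) := by positivity
  have hs0 : ∑ l : Fin (K + 1), Real.exp (theta2 θ l + theta12 θ 0 l) =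
      1 + ∑ j : Fin K, Real.exp (θ (Sum.inl j) + θ (Sum.inr j)) := by
    rw [Fin.sum_univ_castSucc]
    simp [theta2, theta12, add_comm]
  have hs1 : ∑ l : Fin (K + 1), Real.exp (theta2 θ l + theta12 θ 1 l) =
      1 + ∑ j : Fin K, Real.exp (θ (Sum.inl j)) := by
    rw [Fin.sum_univ_castSucc]
    simp [theta2, theta12, add_comm]
  unfold cellProb condProb
  rw [add_assoc, Real.exp_add]
  fin_cases i
  · simp only [Fin.zero_eta, Fin.isValue]
    rw [hs0]
    simp only [uParam, u1Param, if_true]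
    rw [Real.exp_add, Real.exp_add, Real.exp_sub, Real.exp_sub, Real.exp_log h1, Real.exp_log ht,
      Real.exp_log hA, Real.exp_log (by positivity), Real.exp_log (by positivity)]
    field_simp
  · simp only [Fin.mk_one, Fin.isValue]
    rw [hs1]
    simp only [uParam, u1Param, one_ne_zero, if_false, add_zero]
    rw [Real.exp_sub, Real.exp_sub, Real.exp_log h1, Real.exp_log ht, Real.exp_log hA]
    field_simp

/-- The `h × h` matrix `G_h` with `1` on the diagonal and `-1` on the first superdiagonal. -/
def matG (h : ℕ) : Matrix (Fin h) (Fin h) ℝ :=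
  Matrix.of fun i j => if i = j then 1 else if (j : ℕ) = (i : ℕ) + 1 then -1 else 0

/-- The matrix `R = (0, G_{J-1})`. -/
def matR (K : ℕ) : Matrix (Fin K) (Fin K ⊕ Fin K) ℝ := Matrix.fromCols 0 (matG K)

/-- The matrix `R(S)` of the rows of `R` with index in `S`. -/
def matRS {K : ℕ} (S : Finset (Fin K)) : Matrix S (Fin K ⊕ Fin K) ℝ :=
  (matR K).submatrix (fun s => (s : Fin K)) id

/-- The parameter space `Θ₀ = {θ : R θ = 0}`. -/
def nullSpace (K : ℕ) : Set (Param K) := {θ | (matR K).mulVec θ = 0}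

/-- The parameter space `Θ(S) = {θ : R(S) θ = 0}`. -/
def restrictedSpace {K : ℕ} (S : Finset (Fin K)) : Set (Param K) := {θ | (matRS S).mulVec θ = 0}

/-- The kernel of the loglikelihood, `ℓ(N; θ) = ∑_{i,j} N_{ij} log p_{ij}(θ)`. -/
def logLik {K : ℕ} (n : Fin 2 → ℕ) (N : Fin 2 → Fin (K + 1) → ℕ) (θ : Param K) : ℝ :=
  ∑ i, ∑ j, (N i j : ℝ) * Real.log (cellProb n θ i j)

/-- `θ` maximizes the likelihood of the table `N` over the parameter space `Θ`. -/
def IsMLE {K : ℕ} (n : Fin 2 → ℕ) (N : Fin 2 → Fin (K + 1) → ℕ) (Θ : Set (Param K))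
    (θ : Param K) : Prop :=
  θ ∈ Θ ∧ IsMaxOn (logLik n N) Θ θ

/-- `T` is a maximum likelihood estimator over `Θ`: a function of the table whose value is a
maximizer of the likelihood over `Θ` whenever there is one.  (For tables with too many empty cells
the supremum of the likelihood is not attained; the value of `T` there is unrestricted.) -/
def IsMLEstimator {K : ℕ} (n : Fin 2 → ℕ) (Θ : Set (Param K))
    (T : (Fin 2 → Fin (K + 1) → ℕ) → Param K) : Prop :=
  ∀ N, (∃ θ, IsMLE n N Θ θ) → IsMLE n N Θ (T N)

/-- The probability of the vector of counts `k` under the multinomial distribution `M(n, π)`. -/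
def multinomialProb {J : ℕ} (n : ℕ) (π : Fin J → ℝ) (k : Fin J → ℕ) : ℝ :=
  if ∑ j, k j = n then (Nat.multinomial Finset.univ k : ℝ) * ∏ j, π j ^ k j else 0

/-- Under `μ` the table `N` has the product-multinomial distribution: its two rows are independent
and the `i`-th row is `M(n_i, π_i)`. -/
structure IsProductMultinomial {K : ℕ} {Ω : Type*} [MeasurableSpace Ω] (μ : Measure Ω)
    (n : Fin 2 → ℕ) (π : Fin 2 → Fin (K + 1) → ℝ) (N : Ω → Fin 2 → Fin (K + 1) → ℕ) : Prop where
  measurable : Measurable N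
  indep : IndepFun (fun ω => N ω 0) (fun ω => N ω 1) μ
  law : ∀ i k, μ.real {ω | N ω i = k} = multinomialProb (n i) (π i) k

/-- The functions `φ` that generate the divergences: convex on `(0, ∞)` with
`φ(1) = φ'(1) = 0` and `φ''(1) > 0` (in particular `φ''(1)` exists). -/
structure IsDivergenceFunction (φ : ℝ → ℝ) : Prop where
  convex : ConvexOn ℝ (Set.Ioi 0) φ
  map_one : φ 1 = 0
  deriv_one : HasDerivAt φ 0 1
  differentiableAt_deriv : DifferentiableAt ℝ (deriv φ) 1
  deriv2_one_pos : 0 < deriv (deriv φ) 1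

/-- The `φ`-divergence `d_φ(p, q) = ∑_{i,j} q_{ij} φ(p_{ij} / q_{ij})`.  It is used only for second
arguments `q = p(θ)`, all of whose entries are positive, so that no convention for a vanishing
denominator is needed. -/
def phiDiv {K : ℕ} (φ : ℝ → ℝ) (p q : Fin 2 → Fin (K + 1) → ℝ) : ℝ :=
  ∑ i, ∑ j, q i j * φ (p i j / q i j)

/-- The relative frequencies `N / n`. -/
def relFreq {K : ℕ} (n : Fin 2 → ℕ) (N : Fin 2 → Fin (K + 1) → ℕ) (i : Fin 2) (j : Fin (K + 1)) :
    ℝ :=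
  (N i j : ℝ) / total n

/-- `T_φ(r, p, q) = (2n / φ''(1)) (d_φ(r, q) - d_φ(r, p))`. -/
def statT {K : ℕ} (φ : ℝ → ℝ) (n : Fin 2 → ℕ) (r p q : Fin 2 → Fin (K + 1) → ℝ) : ℝ :=
  2 * total n / deriv (deriv φ) 1 * (phiDiv φ r q - phiDiv φ r p)

/-- `S_φ(p, q) = (2n / φ''(1)) d_φ(p, q)`. -/
def statS {K : ℕ} (φ : ℝ → ℝ) (n : Fin 2 → ℕ) (p q : Fin 2 → Fin (K + 1) → ℝ) : ℝ :=
  2 * total n / deriv (deriv φ) 1 * phiDiv φ p q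

/-- `S_φ(p(θ̂(S)), p(θ̂))` as a function of the table `N`, for estimators `θhatS` of `θ̂(S)` and
`θhat` of `θ̂`. -/
def testS {K : ℕ} (φ : ℝ → ℝ) (n : Fin 2 → ℕ)
    (θhatS θhat : (Fin 2 → Fin (K + 1) → ℕ) → Param K) (N : Fin 2 → Fin (K + 1) → ℕ) : ℝ :=
  statS φ n (cellProb n (θhatS N)) (cellProb n (θhat N))

/-- `T_φ(p̄, p(θ̂(S)), p(θ̂))` as a function of the table `N`, for estimators `θhatS` of `θ̂(S)` and
`θhat` of `θ̂`. -/
def testT {K : ℕ} (φ : ℝ → ℝ) (n : Fin 2 → ℕ)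
    (θhatS θhat : (Fin 2 → Fin (K + 1) → ℕ) → Param K) (N : Fin 2 → Fin (K + 1) → ℕ) : ℝ :=
  statT φ n (relFreq n N) (cellProb n (θhatS N)) (cellProb n (θhat N))

/-- The chi-squared distribution with `k` degrees of freedom: the law of the sum of squares of `k`
independent standard normal variables (the point mass at `0` when `k = 0`). -/
def chiSquared (k : ℕ) : Measure ℝ :=
  (Measure.pi fun _ : Fin k => gaussianReal 0 1).map fun z => ∑ i, z i ^ 2

instance isProbabilityMeasure_chiSquared (k : ℕ) : IsProbabilityMeasure (chiSquared k) :=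
  Measure.isProbabilityMeasure_map
    (by fun_prop : Measurable fun z : Fin k → ℝ => ∑ i, z i ^ 2).aemeasurable

end LoglinearTest

end

open LoglinearTest

/-!
# Asymptotic distribution of divergence statistics in the two-sample loglinear model

The argument rests on explicit maximum likelihood estimators, which make the asymptotic part
elementary.

The restriction `R(S) θ = 0` says that the odds `π₁ⱼ / π₂ⱼ` are constant on the blocks of
consecutive categories obtained by joining `j` and `j + 1` for `j ∈ S` (`exists_surjective_blockMap`,
`mem_restrictedSpace_iff`); there are `J - card S` blocks, and the null hypothesis is the case of a
single block, `π₁ = π₂`.  For a table without empty cells the likelihood over `Θ(S)` is maximized by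
`π̂ᵢⱼ = (N_{iB} / nᵢ) (N_{+j} / N_{+B})`, where `B` is the block of `j`
(`condProb_mlEstimator`): the log ratio of two members of the model is a sum of a row effect, a
column effect and a block effect, and `π̂` has the row, column and block sums of the table, so that
the loglikelihood deficit is a Kullback-Leibler divergence.

Let `r = N / n`, `p = p(θ̂(S))`, `q = p(θ̂)`.  When the counts deviate from their expectations by
`O(√n)`, all ratios of `r`, `p`, `q` are `1 + O(1/√n)`, and the second order expansion of `φ` at `1`
turns `S_φ` and `T_φ` into the Pearson statistics `n ∑ (p - q)² / q` and
`n ∑ (r - q)² / q - n ∑ (r - p)² / p`.  These agree up to `o(1)` by Pythagoras: `p / q` is constant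
on blocks and `r - p` sums to zero over them (`tendsto_statS_statT_sub_pearson`).  Since `p / q` is
constant on blocks, the common value is Pearson's homogeneity statistic of the `2 × (J - card S)`
table of block counts, which is asymptotically `∑_b Y_b² / w_b`, where `w_b` is the probability of
the block `b` and `Y_b` is the difference of its relative frequencies in the two samples multiplied
by `√(n₁ n₂ / n)` (`tendsto_testS_testT_sub`).

This deterministic statement holds along arbitrary filters, so it applies to the net of all sample
points at which the standardized counts are bounded by a given constant.  As these are bounded in
probability, the deterministic limits become limits in probability
(`tendsto_measure_of_tendsto_on_bounded`).  The characteristic function of a multinomial vector is a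
power, by the multinomial theorem, and its limit gives both that boundedness and, through Lévy's
continuity theorem, the convergence of `(Y_b / √w_b)_b` to a standard Gaussian vector in the
orthogonal complement of the unit vector `(√w_b)_b` (`tendstoInDistribution_sum_blockScore_sq`).
The squared norm of the limit is chi-squared with `J - card S - 1` degrees of freedom.
-/

namespace LoglinearTest

open Asymptotics

/-! ### Bounded and vanishing quantities -/

theorem tendsto_zero_of_isBigO_one_mul {α : Type*} {l : Filter α} {f g : α → ℝ}
    (hf : f =O[l] fun _ => (1 : ℝ)) (hg : Tendsto g l (𝓝 0)) :
    Tendsto (fun a => f a * g a) l (𝓝 0) := by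
  rw [← isLittleO_one_iff ℝ] at hg ⊢
  simpa using hf.mul_isLittleO hg

theorem isBigO_one_mul {α : Type*} {l : Filter α} {f g : α → ℝ}
    (hf : f =O[l] fun _ => (1 : ℝ)) (hg : g =O[l] fun _ => (1 : ℝ)) :
    (fun a => f a * g a) =O[l] fun _ => (1 : ℝ) := by
  simpa using hf.mul hg

theorem tendsto_one_of_isBigO_sqrt_mul_sub {α : Type*} {l : Filter α} {t ρ : α → ℝ}
    (ht : Tendsto t l atTop)
    (hρ : (fun a => √(t a) * (ρ a - 1)) =O[l] fun _ => (1 : ℝ)) : Tendsto ρ l (𝓝 1) := by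
  have hs : Tendsto (fun a => √(t a)) l atTop := Real.tendsto_sqrt_atTop.comp ht
  have h2 : Tendsto (fun a => ρ a - 1) l (𝓝 0) := by
    refine (tendsto_zero_of_isBigO_one_mul hρ hs.inv_tendsto_atTop).congr' ?_
    filter_upwards [hs.eventually_gt_atTop 0] with a ha
    rw [Pi.inv_apply]
    field_simp
  simpa using h2.add_const 1

/-! ### Second order expansion of the divergence function -/

/-- Second order Taylor expansion of `φ` at `1`, where `φ` and `φ'` vanish. -/
theorem IsDivergenceFunction.isLittleO_sub_sq {φ : ℝ → ℝ} (hφ : IsDivergenceFunction φ) :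
    (fun x => φ x - deriv (deriv φ) 1 / 2 * (x - 1) ^ 2) =o[𝓝 1] fun x => (x - 1) ^ 2 := by
  set c := deriv (deriv φ) 1 with hc
  have hcpos : 0 < c := hφ.deriv2_one_pos
  have hd : HasDerivAt (deriv φ) c 1 := hφ.differentiableAt_deriv.hasDerivAt
  have hd1 : deriv φ 1 = 0 := hφ.deriv_one.deriv
  have hlo : (fun x => deriv φ x - c * (x - 1)) =o[𝓝 1] fun x => x - 1 := by
    have := hd.isLittleO
    simpa [hd1, mul_comm] using this
  rw [isLittleO_iff]
  intro ε hε
  have h1 := (isLittleO_iff.1 hlo) (show 0 < min ε (c / 2) by positivity)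
  obtain ⟨δ, hδ, hball⟩ := Metric.eventually_nhds_iff_ball.1 h1
  -- The derivative does not vanish near `1` except at `1`, so `deriv φ` takes no junk value there.
  have hder : ∀ x ∈ Metric.ball (1 : ℝ) δ, HasDerivAt φ (deriv φ x) x := by
    intro x hx
    by_cases hx1 : x = 1
    · rw [hx1, hd1]; exact hφ.deriv_one
    refine (differentiableAt_of_deriv_ne_zero fun h0 => ?_).hasDerivAt
    have h2 := hball x hx
    rw [h0, zero_sub, norm_neg, norm_mul, Real.norm_of_nonneg hcpos.le] at h2
    have h3 : 0 < ‖x - 1‖ := norm_pos_iff.2 (sub_ne_zero.2 hx1)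
    have h4 : min ε (c / 2) ≤ c / 2 := min_le_right _ _
    nlinarith
  filter_upwards [Metric.ball_mem_nhds (1 : ℝ) hδ] with x hx
  have hseg : ∀ y ∈ Set.uIcc 1 x, y ∈ Metric.ball (1 : ℝ) δ ∧ ‖y - 1‖ ≤ ‖x - 1‖ := by
    intro y hy
    have : |y - 1| ≤ |x - 1| := Set.abs_sub_left_of_mem_uIcc hy
    refine ⟨?_, this⟩
    rw [Metric.mem_ball, Real.dist_eq] at hx ⊢
    exact this.trans_lt hx
  have hmv := Convex.norm_image_sub_le_of_norm_hasDerivWithin_le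
    (f := fun y => φ y - c / 2 * (y - 1) ^ 2) (f' := fun y => deriv φ y - c * (y - 1))
    (s := Set.uIcc 1 x) (C := ε * ‖x - 1‖) (x := 1) (y := x)
    (fun y hy => by
      have h5 : HasDerivAt (fun y : ℝ => c / 2 * (y - 1) ^ 2) (c * (y - 1)) y := by
        have := (((hasDerivAt_id y).sub_const 1).pow 2).const_mul (c / 2)
        convert! this using 1
        simp; ring
      exact ((hder y (hseg y hy).1).sub h5).hasDerivWithinAt)
    (fun y hy => by
      refine (hball y (hseg y hy).1).trans ?_
      exact mul_le_mul (min_le_left _ _) (hseg y hy).2 (norm_nonneg _) hε.le)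
    (convex_uIcc _ _) Set.left_mem_uIcc Set.right_mem_uIcc
  simp only [hφ.map_one, sub_self] at hmv
  rw [norm_pow, pow_two ‖x - 1‖, ← mul_assoc]
  simpa using hmv

/-- At arguments `ρ = 1 + O(1/√t)` the remainder of the second order expansion is `o(1/t)`. -/
theorem IsDivergenceFunction.tendsto_mul_sub_sq {α : Type*} {l : Filter α} {φ : ℝ → ℝ}
    (hφ : IsDivergenceFunction φ) {t ρ : α → ℝ} (ht : Tendsto t l atTop)
    (hρ : (fun a => √(t a) * (ρ a - 1)) =O[l] fun _ => (1 : ℝ)) :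
    Tendsto (fun a => t a * (φ (ρ a) - deriv (deriv φ) 1 / 2 * (ρ a - 1) ^ 2)) l (𝓝 0) := by
  have h3 := hφ.isLittleO_sub_sq.comp_tendsto (tendsto_one_of_isBigO_sqrt_mul_sub ht hρ)
  have h4 := (isBigO_refl t l).mul_isLittleO h3
  rw [← isLittleO_one_iff ℝ]
  refine h4.trans_isBigO ?_
  refine ((hρ.pow 2).congr' ?_ (by simp))
  filter_upwards [ht.eventually_ge_atTop 0] with a ha
  simp [mul_pow, Real.sq_sqrt ha]

/-! ### Asymptotics of counts -/

/-- The relative frequency of a count within a total sample size `t` converges when the count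
deviates from its expectation `n w` by `O(√t)`. -/
theorem tendsto_count_div {α : Type*} {l : Filter α} {t n a : α → ℝ} {w ν : ℝ}
    (ht : Tendsto t l atTop) (hn : Tendsto (fun x => n x / t x) l (𝓝 ν))
    (ha : (fun x => (a x - n x * w) / √(t x)) =O[l] fun _ => (1 : ℝ)) :
    Tendsto (fun x => a x / t x) l (𝓝 (ν * w)) := by
  have hs : Tendsto (fun a => √(t a)) l atTop := Real.tendsto_sqrt_atTop.comp ht
  have h1 := (hn.mul_const w).add (tendsto_zero_of_isBigO_one_mul ha hs.inv_tendsto_atTop)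
  rw [add_zero] at h1
  refine h1.congr' ?_
  filter_upwards [ht.eventually_gt_atTop 0] with x hx
  have h2 : √(t x) * √(t x) = t x := Real.mul_self_sqrt hx.le
  have h3 : 0 < √(t x) := Real.sqrt_pos.2 hx
  rw [Pi.inv_apply]
  set s := √(t x)
  rw [← h2]
  field_simp
  ring

/-- For two counts `a`, `b` with the same success probability `w` in samples of sizes `n`, `k`, the
ratio of `a` to its value fitted under homogeneity is `1 + O(1/√t)`, where `t = n + k`. -/
theorem isBigO_sqrt_mul_count_ratio {α : Type*} {l : Filter α} {t n k a b : α → ℝ} {w ν κ : ℝ}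
    (hw : 0 < w) (hν : 0 < ν) (hκ : 0 < κ)
    (ht : Tendsto t l atTop) (htn : ∀ x, t x = n x + k x)
    (hn : Tendsto (fun x => n x / t x) l (𝓝 ν)) (hk : Tendsto (fun x => k x / t x) l (𝓝 κ))
    (ha : (fun x => (a x - n x * w) / √(t x)) =O[l] fun _ => (1 : ℝ))
    (hb : (fun x => (b x - k x * w) / √(t x)) =O[l] fun _ => (1 : ℝ)) :
    (fun x => √(t x) * (a x * t x / (n x * (a x + b x)) - 1)) =O[l] fun _ => (1 : ℝ) := by
  have hat := tendsto_count_div ht hn ha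
  have hbt := tendsto_count_div ht hk hb
  have hden : Tendsto (fun x => (n x / t x * (a x / t x + b x / t x))⁻¹) l
      (𝓝 (ν * (ν * w + κ * w))⁻¹) := (hn.mul (hat.add hbt)).inv₀ (by positivity)
  have h1 := ((isBigO_one_mul (hk.isBigO_one ℝ) ha).sub
    (isBigO_one_mul (hn.isBigO_one ℝ) hb))
  refine (isBigO_one_mul h1 (hden.isBigO_one ℝ)).congr' ?_ EventuallyEq.rfl
  filter_upwards [ht.eventually_gt_atTop 0, hn.eventually_const_lt hν,
    hat.eventually_const_lt (by positivity : 0 < ν * w),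
    hbt.eventually_const_lt (by positivity : 0 < κ * w)] with x hx h2 h3 h4
  have h5 : √(t x) * √(t x) = t x := Real.mul_self_sqrt hx.le
  have h6 : 0 < √(t x) := Real.sqrt_pos.2 hx
  have h7 : 0 < n x := (div_pos_iff_of_pos_right hx).1 h2
  have h8 : 0 < a x := (div_pos_iff_of_pos_right hx).1 h3
  have h9 : 0 < b x := (div_pos_iff_of_pos_right hx).1 h4
  have hab : 0 < a x + b x := by positivity
  have h10 : a x * t x - n x * (a x + b x) = k x * (a x - n x * w) - n x * (b x - k x * w) := by
    rw [htn]; ring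
  have h11 : a x * t x / (n x * (a x + b x)) - 1 =
      (k x * (a x - n x * w) - n x * (b x - k x * w)) / (n x * (a x + b x)) := by
    rw [← h10]; field_simp
  rw [h11]
  set s := √(t x)
  rw [← h5]
  field_simp

/-! ### The restrictions `R(S) θ = 0` and blocks of categories -/

/-- The categories fall into `J - card S` blocks of consecutive categories, `j` and `j + 1` being
joined when `j ∈ S`.  A function satisfies the restrictions indexed by `S` iff it is constant on
blocks. -/
theorem exists_surjective_blockMap {K : ℕ} (S : Finset (Fin K)) :
    ∃ blk : Fin (K + 1) → Fin (K - S.card + 1), Function.Surjective blk ∧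
      ∀ f : Fin (K + 1) → ℝ, (∀ h ∈ S, f h.castSucc = f h.succ) ↔
        ∀ j j', blk j = blk j' → f j = f j' := by
  classical
  -- `c j` counts the cut points, i.e. the indices outside `S`, that lie to the left of `j`.
  let c : Fin (K + 1) → ℕ := fun j => (Sᶜ.filter fun h => h.castSucc < j).card
  have hc0 : c 0 = 0 := by simp [c]
  have hmem : ∀ h ∈ S, c h.succ = c h.castSucc := by
    intro h hh
    refine congrArg Finset.card (Finset.filter_congr fun x hx => ?_)
    have hne : x ≠ h := by rintro rfl; simp [hh] at hx
    have hne' : (x : ℕ) ≠ h := fun e => hne (Fin.ext e)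
    simp only [Fin.lt_def, Fin.val_castSucc, Fin.val_succ]
    omega
  have hnot : ∀ h ∉ S, c h.succ = c h.castSucc + 1 := by
    intro h hh
    have : (Sᶜ.filter fun x => x.castSucc < h.succ) =
        insert h (Sᶜ.filter fun x => x.castSucc < h.castSucc) := by
      ext x
      simp only [Finset.mem_filter, Finset.mem_insert, Finset.mem_compl, Fin.lt_def,
        Fin.val_castSucc, Fin.val_succ]
      constructor
      · rintro ⟨h1, h2⟩
        by_cases hx : x = h
        · exact Or.inl hx
        · have hne' : (x : ℕ) ≠ h := fun e => hx (Fin.ext e)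
          exact Or.inr ⟨h1, by omega⟩
      · rintro (rfl | ⟨h1, h2⟩)
        · exact ⟨hh, by omega⟩
        · exact ⟨h1, by omega⟩
    simp only [c]
    rw [this, Finset.card_insert_of_notMem (by simp)]
  have hstep : ∀ h : Fin K, c h.castSucc ≤ c h.succ := by
    intro h
    by_cases hh : h ∈ S
    · exact (hmem h hh).ge
    · rw [hnot h hh]; exact Nat.le_succ _
  have hmono : Monotone c := Fin.monotone_iff_le_succ.2 hstep
  have hlast : c (Fin.last K) = K - S.card := by
    simp [c, Fin.castSucc_lt_last, Finset.card_compl]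
  have hlt : ∀ j, c j < K - S.card + 1 := fun j =>
    Nat.lt_succ_of_le (hlast ▸ hmono (Fin.le_last j))
  have hsurj : ∀ j : Fin (K + 1), ∀ v ≤ c j, ∃ j', c j' = v := by
    intro j
    induction j using Fin.induction with
    | zero => intro v hv; exact ⟨0, by omega⟩
    | succ h ih =>
      intro v hv
      by_cases hh : h ∈ S
      · exact ih v (by rw [hmem h hh] at hv; exact hv)
      · rw [hnot h hh] at hv
        rcases Nat.lt_or_ge (c h.castSucc) v with h1 | h1
        · exact ⟨h.succ, by rw [hnot h hh]; omega⟩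
        · exact ih v h1
  refine ⟨fun j => ⟨c j, hlt j⟩, fun v => ?_, fun f => ⟨fun hf => ?_, fun hf h hh => ?_⟩⟩
  · obtain ⟨j, hj⟩ := hsurj (Fin.last K) v (by rw [hlast]; exact Nat.le_of_lt_succ v.2)
    exact ⟨j, Fin.ext hj⟩
  · have key : ∀ j' : Fin (K + 1), ∀ j ≤ j', c j = c j' → f j = f j' := by
      intro j'
      induction j' using Fin.induction with
      | zero => intro j hj _; rw [Fin.le_zero_iff.1 hj]
      | succ h ih =>
        intro j hj hcj
        rcases hj.eq_or_lt with rfl | hj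
        · rfl
        have hj' : j ≤ h.castSucc := Fin.le_castSucc_iff.2 hj
        have h1 := hmono hj'
        have h2 := hstep h
        have hh : h ∈ S := by
          by_contra hh
          have := hnot h hh
          omega
        rw [ih j hj' (by omega), hf h hh]
    intro j j' hjj'
    have hjj : c j = c j' := congrArg Fin.val hjj'
    rcases le_total j j' with h | h
    · exact key j' j h hjj
    · exact (key j j' h hjj.symm).symm
  · exact hf _ _ (Fin.ext (hmem h hh).symm)

theorem matG_mulVec {K : ℕ} (v : Fin K → ℝ) (h : Fin K) :
    (matG K).mulVec v h = Fin.snoc (α := fun _ => ℝ) v 0 h.castSucc -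
      Fin.snoc (α := fun _ => ℝ) v 0 h.succ := by
  rw [Matrix.mulVec, dotProduct]
  rw [Fin.snoc_castSucc (α := fun _ => ℝ)]
  have hsplit : ∀ j : Fin K, matG K h j * v j =
      (if h = j then v j else 0) - (if (j : ℕ) = (h : ℕ) + 1 then v j else 0) := by
    intro j
    simp only [matG, Matrix.of_apply]
    by_cases h1 : h = j
    · subst h1; simp
    · simp only [h1, if_false]; split_ifs <;> simp
  rw [Finset.sum_congr rfl fun j _ => hsplit j, Finset.sum_sub_distrib]
  simp only [Finset.sum_ite_eq, Finset.mem_univ, if_true]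
  congr 1
  by_cases hk : (h : ℕ) + 1 < K
  · have hs : h.succ = Fin.castSucc ⟨h + 1, hk⟩ := Fin.ext (by simp)
    rw [hs, Fin.snoc_castSucc (α := fun _ => ℝ), Finset.sum_eq_single ⟨h + 1, hk⟩]
    · simp
    · intro j _ hj
      rw [if_neg]
      exact fun e => hj (Fin.ext e)
    · simp
  · have hs : h.succ = Fin.last K := Fin.ext (by simp; omega)
    rw [hs, Fin.snoc_last]
    refine Finset.sum_eq_zero fun j _ => ?_
    rw [if_neg (by omega)]

theorem matR_mulVec {K : ℕ} (θ : Param K) (h : Fin K) :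
    (matR K).mulVec θ h = theta12 θ 0 h.castSucc - theta12 θ 0 h.succ := by
  have h1 : (matR K).mulVec θ = (matG K).mulVec fun l => θ (Sum.inr l) := by
    rw [matR, Matrix.fromCols_mulVec]
    simp [Function.comp_def]
  rw [h1, matG_mulVec]
  simp [theta12]

theorem mem_restrictedSpace_iff {K : ℕ} (S : Finset (Fin K)) (θ : Param K) :
    θ ∈ restrictedSpace S ↔ ∀ h ∈ S, theta12 θ 0 h.castSucc = theta12 θ 0 h.succ := by
  have h1 : ∀ s : S, (matRS S).mulVec θ s = (matR K).mulVec θ s := fun s => rfl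
  simp only [restrictedSpace, Set.mem_ofPred_eq, funext_iff, h1, matR_mulVec, Pi.zero_apply,
    sub_eq_zero, Subtype.forall]

theorem nullSpace_eq_restrictedSpace_univ (K : ℕ) :
    nullSpace K = restrictedSpace (Finset.univ : Finset (Fin K)) := by
  ext θ
  rw [mem_restrictedSpace_iff]
  simp only [nullSpace, Set.mem_ofPred_eq, funext_iff, matR_mulVec, Pi.zero_apply, sub_eq_zero,
    Finset.mem_univ, forall_true_left]

/-- Under the null hypothesis the two samples have the same distribution. -/
theorem condProb_eq_of_mem_nullSpace {K : ℕ} {θ : Param K} (hθ : θ ∈ nullSpace K) (i : Fin 2)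
    (j : Fin (K + 1)) : condProb θ i j = condProb θ 1 j := by
  have h0 : ∀ j, theta12 θ 0 j = 0 := by
    intro j
    induction j using Fin.reverseInduction with
    | last => simp [theta12]
    | cast h ih =>
      have := congrFun (show (matR K).mulVec θ = 0 from hθ) h
      rw [matR_mulVec, ih] at this
      simpa using this
  have h1 : ∀ j, theta12 θ 1 j = 0 := fun j => by simp [theta12]
  have h2 : ∀ i j, theta12 θ i j = 0 := fun i j => by
    fin_cases i
    · exact h0 j
    · exact h1 j
  simp only [condProb, h2]

/-! ### Maximum likelihood estimators in closed form -/

theorem log_condProb {K : ℕ} (θ : Param K) (i : Fin 2) (j : Fin (K + 1)) :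
    Real.log (condProb θ i j) = theta2 θ j + theta12 θ i j -
      Real.log (∑ l : Fin (K + 1), Real.exp (theta2 θ l + theta12 θ i l)) := by
  rw [condProb, Real.log_div (Real.exp_pos _).ne'
    (Finset.sum_pos (fun _ _ => Real.exp_pos _) Finset.univ_nonempty).ne', Real.log_exp]

/-- The saturated model: every pair of positive probability vectors is attained, and the
interaction parameters are the log odds ratios relative to the reference category. -/
theorem exists_condProb_eq {K : ℕ} (π : Fin 2 → Fin (K + 1) → ℝ) (hπ : ∀ i j, 0 < π i j)
    (hsum : ∀ i, ∑ j, π i j = 1) :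
    ∃ θ : Param K, condProb θ = π ∧ ∀ j, theta12 θ 0 j =
      Real.log (π 0 j / π 1 j) - Real.log (π 0 (Fin.last K) / π 1 (Fin.last K)) := by
  let θ : Param K := Sum.elim
    (fun j => Real.log (π 1 j.castSucc / π 1 (Fin.last K)))
    (fun j => Real.log (π 0 j.castSucc / π 1 j.castSucc) -
      Real.log (π 0 (Fin.last K) / π 1 (Fin.last K)))
  have h12 : ∀ j, theta12 θ 0 j =
      Real.log (π 0 j / π 1 j) - Real.log (π 0 (Fin.last K) / π 1 (Fin.last K)) := by
    intro j
    induction j using Fin.lastCases with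
    | last => simp [theta12]
    | cast j => simp [theta12, θ]
  have h2 : ∀ j, theta2 θ j = Real.log (π 1 j / π 1 (Fin.last K)) := by
    intro j
    induction j using Fin.lastCases with
    | last => simp [theta2, div_self (hπ 1 _).ne']
    | cast j => simp [theta2, θ]
  have h12' : ∀ j, theta12 θ 1 j = 0 := fun j => by simp [theta12]
  have hexp : ∀ i j, Real.exp (theta2 θ j + theta12 θ i j) = π i j / π i (Fin.last K) := by
    intro i j
    have := hπ 0 j; have := hπ 1 j; have := hπ 0 (Fin.last K); have := hπ 1 (Fin.last K)
    fin_cases i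
    · simp only [Fin.zero_eta]
      rw [h2, h12, Real.exp_add, Real.exp_sub, Real.exp_log (by positivity),
        Real.exp_log (by positivity), Real.exp_log (by positivity)]
      field_simp
    · simp only [Fin.mk_one]
      rw [h2, h12', add_zero, Real.exp_log (by positivity)]
  refine ⟨θ, ?_, h12⟩
  funext i j
  have := hπ i (Fin.last K)
  simp only [condProb, hexp]
  rw [← Finset.sum_div, hsum]
  field_simp

/-- **Gibbs' inequality** with its case of equality. -/
theorem eq_of_sum_mul_log_div_nonneg {ι : Type*} [Fintype ι] {p q : ι → ℝ}
    (hp : ∀ j, 0 < p j) (hq : ∀ j, 0 < q j) (hsum : ∑ j, q j = ∑ j, p j) :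
    ∑ j, p j * (Real.log (q j) - Real.log (p j)) ≤ 0 ∧
      (0 ≤ ∑ j, p j * (Real.log (q j) - Real.log (p j)) → q = p) := by
  have hterm : ∀ j, p j * (Real.log (q j) - Real.log (p j)) ≤ q j - p j := by
    intro j
    rw [← Real.log_div (hq j).ne' (hp j).ne']
    have := Real.log_le_sub_one_of_pos (div_pos (hq j) (hp j))
    calc p j * Real.log (q j / p j) ≤ p j * (q j / p j - 1) :=
          mul_le_mul_of_nonneg_left this (hp j).le
      _ = q j - p j := by have := (hp j).ne'; field_simp
  have hzero : ∑ j, (q j - p j) = 0 := by rw [Finset.sum_sub_distrib, hsum, sub_self]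
  refine ⟨(Finset.sum_le_sum fun j _ => hterm j).trans hzero.le, fun h0 => ?_⟩
  by_contra hne
  obtain ⟨j, hj⟩ := Function.ne_iff.1 hne
  have hlt : p j * (Real.log (q j) - Real.log (p j)) < q j - p j := by
    rw [← Real.log_div (hq j).ne' (hp j).ne']
    have := Real.log_lt_sub_one_of_pos (div_pos (hq j) (hp j))
      (fun e => hj ((div_eq_one_iff_eq (hp j).ne').1 e))
    calc p j * Real.log (q j / p j) < p j * (q j / p j - 1) :=
          mul_lt_mul_of_pos_left this (hp j)
      _ = q j - p j := by have := (hp j).ne'; field_simp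
  have := Finset.sum_lt_sum (fun j _ => hterm j) ⟨j, Finset.mem_univ j, hlt⟩
  linarith

/-- The sum of `f` over the block `b`, the set of all `l` with `blk l = b`. -/
noncomputable def blockSum {ι β : Type*} [Fintype ι] [DecidableEq β] (blk : ι → β) (f : ι → ℝ)
    (b : β) : ℝ :=
  ∑ l with blk l = b, f l

theorem sum_mul_comp_eq_sum_blockSum_mul {ι β : Type*} [Fintype ι] [Fintype β] [DecidableEq β]
    (blk : ι → β) (f : ι → ℝ) (g : β → ℝ) :
    ∑ j, f j * g (blk j) = ∑ b, blockSum blk f b * g b := by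
  rw [← Finset.sum_fiberwise (s := Finset.univ) (g := blk)]
  refine Finset.sum_congr rfl fun b _ => ?_
  rw [blockSum, Finset.sum_mul]
  refine Finset.sum_congr rfl fun j hj => ?_
  rw [(Finset.mem_filter.1 hj).2]

/-- The maximum likelihood estimate of `Pr(Y = j | X = i)` when the odds of the first against the
second sample are constant on blocks: the relative frequency of the block of `j` in sample `i`
times the relative frequency of `j` within its block in the pooled sample. -/
noncomputable def fitted {J : ℕ} {β : Type*} [DecidableEq β] (blk : Fin J → β) (n : Fin 2 → ℝ)
    (N : Fin 2 → Fin J → ℝ) (i : Fin 2) (j : Fin J) : ℝ :=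
  blockSum blk (N i) (blk j) * (N 0 j + N 1 j) /
    (n i * blockSum blk (fun l => N 0 l + N 1 l) (blk j))

theorem blockSum_add {ι β : Type*} [Fintype ι] [DecidableEq β] (blk : ι → β) (f g : ι → ℝ)
    (b : β) : blockSum blk (fun l => f l + g l) b = blockSum blk f b + blockSum blk g b :=
  Finset.sum_add_distrib

theorem blockSum_pos {ι β : Type*} [Fintype ι] [DecidableEq β] {blk : ι → β} {f : ι → ℝ}
    (hf : ∀ j, 0 < f j) (j : ι) : 0 < blockSum blk f (blk j) :=
  Finset.sum_pos (fun l _ => hf l) ⟨j, by simp⟩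

theorem sum_blockSum {ι β : Type*} [Fintype ι] [Fintype β] [DecidableEq β] (blk : ι → β)
    (f : ι → ℝ) : ∑ b, blockSum blk f b = ∑ j, f j :=
  Finset.sum_fiberwise _ _ _

section fitted

variable {J : ℕ} {β : Type*} [DecidableEq β] {blk : Fin J → β} {n : Fin 2 → ℝ}
  {N : Fin 2 → Fin J → ℝ}

theorem fitted_pos (hn : ∀ i, 0 < n i) (hN : ∀ i j, 0 < N i j) (i : Fin 2) (j : Fin J) :
    0 < fitted blk n N i j := by
  have h1 := blockSum_pos (blk := blk) (hN i) j
  have h2 := blockSum_pos (blk := blk) (fun l => add_pos (hN 0 l) (hN 1 l)) j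
  have := hn i; have := hN 0 j; have := hN 1 j
  unfold fitted
  positivity

/-- The fitted distribution reproduces the block counts of each sample. -/
theorem blockSum_mul_fitted (hn : ∀ i, 0 < n i) (hN : ∀ i j, 0 < N i j) (i : Fin 2) (b : β) :
    blockSum blk (fun j => n i * fitted blk n N i j) b = blockSum blk (N i) b := by
  have h1 : blockSum blk (fun j => n i * fitted blk n N i j) b =
      ∑ j with blk j = b, blockSum blk (N i) b / blockSum blk (fun l => N 0 l + N 1 l) b *
        (N 0 j + N 1 j) := by
    refine Finset.sum_congr rfl fun j hj => ?_
    rw [← (Finset.mem_filter.1 hj).2]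
    have h2 := blockSum_pos (blk := blk) (fun l => add_pos (hN 0 l) (hN 1 l)) j
    have := (hn i).ne'
    unfold fitted
    field_simp
  rw [h1, ← Finset.mul_sum]
  change _ * blockSum blk (fun l => N 0 l + N 1 l) b = _
  by_cases hb : ∃ j, blk j = b
  · obtain ⟨j, rfl⟩ := hb
    exact div_mul_cancel₀ _ (blockSum_pos (fun l => add_pos (hN 0 l) (hN 1 l)) j).ne'
  · have : ∀ f : Fin J → ℝ, blockSum blk f b = 0 := fun f => by
      rw [blockSum, Finset.filter_eq_empty_iff.2 (fun j _ hj => hb ⟨j, hj⟩), Finset.sum_empty]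
    simp [this]

theorem sum_fitted [Fintype β] (hn : ∀ i, 0 < n i) (hN : ∀ i j, 0 < N i j)
    (hrow : ∀ i, ∑ j, N i j = n i) (i : Fin 2) : ∑ j, fitted blk n N i j = 1 := by
  have h1 : ∑ j, n i * fitted blk n N i j = n i := by
    rw [← sum_blockSum blk, Finset.sum_congr rfl fun b _ => blockSum_mul_fitted hn hN i b,
      sum_blockSum, hrow]
  rw [← Finset.mul_sum] at h1
  exact mul_left_cancel₀ (hn i).ne' (h1.trans (mul_one _).symm)

/-- The fitted distribution reproduces the pooled counts of the categories. -/
theorem mul_fitted_add_mul_fitted (hn : ∀ i, 0 < n i) (hN : ∀ i j, 0 < N i j) (j : Fin J) :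
    n 0 * fitted blk n N 0 j + n 1 * fitted blk n N 1 j = N 0 j + N 1 j := by
  have h2 := blockSum_pos (blk := blk) (fun l => add_pos (hN 0 l) (hN 1 l)) j
  have h3 := blockSum_add blk (N 0) (N 1) (blk j)
  have := (hn 0).ne'; have := (hn 1).ne'
  unfold fitted
  rw [show n 0 * (blockSum blk (N 0) (blk j) * (N 0 j + N 1 j) /
      (n 0 * blockSum blk (fun l => N 0 l + N 1 l) (blk j))) +
      n 1 * (blockSum blk (N 1) (blk j) * (N 0 j + N 1 j) /
      (n 1 * blockSum blk (fun l => N 0 l + N 1 l) (blk j))) =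
      (blockSum blk (N 0) (blk j) + blockSum blk (N 1) (blk j)) * (N 0 j + N 1 j) /
        blockSum blk (fun l => N 0 l + N 1 l) (blk j) by field_simp, ← h3]
  field_simp

end fitted

/-- Comparison of loglikelihoods: the logarithm of the ratio of two members of the model is of the
form `a_i + b_j + c_{blk j} 1_{i = 0}`, and a member of the model that has the row sums, the column
sums and the block sums of the table can be substituted for the table in the expectation of
such a function.  So the difference of the loglikelihoods is a Kullback-Leibler divergence. -/
theorem logLik_sub_logLik {K : ℕ} {β : Type*} [Fintype β] [DecidableEq β]
    {blk : Fin (K + 1) → β} {n : Fin 2 → ℕ} (hn : ∀ i, 0 < n i)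
    {N : Fin 2 → Fin (K + 1) → ℕ} (hN : ∀ i j, 0 < N i j) (hrow : ∀ i, ∑ j, N i j = n i)
    {θ θ' : Param K} (hθ : ∀ j j', blk j = blk j' → theta12 θ 0 j = theta12 θ 0 j')
    (hθ' : ∀ j j', blk j = blk j' → theta12 θ' 0 j = theta12 θ' 0 j')
    (hfit : condProb θ' = fitted blk (fun i => (n i : ℝ)) (fun i j => (N i j : ℝ))) :
    logLik n N θ - logLik n N θ' = ∑ i, (n i : ℝ) *
      ∑ j, condProb θ' i j * (Real.log (condProb θ i j) - Real.log (condProb θ' i j)) := by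
  have hn' : ∀ i, (0 : ℝ) < n i := fun i => by exact_mod_cast hn i
  have hN' : ∀ i j, (0 : ℝ) < N i j := fun i j => by exact_mod_cast hN i j
  have hrow' : ∀ i, ∑ j, (N i j : ℝ) = n i := fun i => by exact_mod_cast hrow i
  have ht : 0 < total n := add_pos (hn' 0) (hn' 1)
  have hlog : ∀ (θ : Param K) i j, Real.log (cellProb n θ i j) =
      Real.log ((n i : ℝ) / total n) + Real.log (condProb θ i j) := fun θ i j => by
    rw [cellProb_eq n hn, Real.log_mul (div_pos (hn' i) ht).ne' (condProb_pos _ _ _).ne']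
  have hd : logLik n N θ - logLik n N θ' = ∑ i, ∑ j, (N i j : ℝ) *
      (Real.log (condProb θ i j) - Real.log (condProb θ' i j)) := by
    rw [logLik, logLik, ← Finset.sum_sub_distrib]
    refine Finset.sum_congr rfl fun i _ => ?_
    rw [← Finset.sum_sub_distrib]
    refine Finset.sum_congr rfl fun j _ => ?_
    rw [hlog, hlog]; ring
  rw [hd]
  simp only [Finset.mul_sum, ← mul_assoc]
  -- The difference of the interaction parameters depends on the block only.
  obtain ⟨g, hg⟩ : ∃ g : β → ℝ, ∀ j, theta12 θ 0 j - theta12 θ' 0 j = g (blk j) := by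
    refine ⟨Function.extend blk (fun j => theta12 θ 0 j - theta12 θ' 0 j) 0, fun j => ?_⟩
    have hfac : Function.FactorsThrough (fun j => theta12 θ 0 j - theta12 θ' 0 j) blk :=
      fun j j' hj => by simp only [hθ j j' hj, hθ' j j' hj]
    exact (hfac.extend_apply _ j).symm
  let A : Param K → Fin 2 → ℝ := fun θ i =>
    Real.log (∑ l : Fin (K + 1), Real.exp (theta2 θ l + theta12 θ i l))
  have hzero : ∀ θ : Param K, ∀ j, theta12 θ 1 j = 0 := fun θ j => by simp [theta12]
  have hexpand : ∀ w : Fin 2 → Fin (K + 1) → ℝ,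
      ∑ i, ∑ j, w i j * (Real.log (condProb θ i j) - Real.log (condProb θ' i j)) =
        ∑ j, (w 0 j + w 1 j) * (theta2 θ j - theta2 θ' j) + ∑ j, w 0 j * g (blk j) +
          ∑ i, (∑ j, w i j) * (A θ' i - A θ i) := by
    intro w
    simp only [Fin.sum_univ_two, Finset.sum_mul, ← Finset.sum_add_distrib, log_condProb, hzero, A,
      ← hg]
    refine Finset.sum_congr rfl fun j _ => ?_
    ring
  rw [hexpand, hexpand, hfit]
  congr 1
  · congr 1
    · refine Finset.sum_congr rfl fun j _ => ?_
      rw [mul_fitted_add_mul_fitted hn' hN']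
    · rw [sum_mul_comp_eq_sum_blockSum_mul blk (fun j => (N 0 j : ℝ)),
        sum_mul_comp_eq_sum_blockSum_mul blk (fun j => (n 0 : ℝ) * fitted _ _ _ 0 j)]
      exact Finset.sum_congr rfl fun b _ => by rw [blockSum_mul_fitted hn' hN']
  · refine Finset.sum_congr rfl fun i _ => ?_
    rw [← Finset.mul_sum, sum_fitted hn' hN' hrow', mul_one, hrow']

/-- For a table without empty cells the maximum likelihood estimator over `Θ(S)` is explicit. -/
theorem condProb_mlEstimator {K : ℕ} {β : Type*} [Fintype β] [DecidableEq β]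
    {S : Finset (Fin K)} {blk : Fin (K + 1) → β}
    (hblk : ∀ f : Fin (K + 1) → ℝ, (∀ h ∈ S, f h.castSucc = f h.succ) ↔
        ∀ j j', blk j = blk j' → f j = f j')
    {n : Fin 2 → ℕ} (hn : ∀ i, 0 < n i)
    {N : Fin 2 → Fin (K + 1) → ℕ} (hN : ∀ i j, 0 < N i j) (hrow : ∀ i, ∑ j, N i j = n i)
    {T : (Fin 2 → Fin (K + 1) → ℕ) → Param K} (hT : IsMLEstimator n (restrictedSpace S) T) :
    condProb (T N) = fitted blk (fun i => (n i : ℝ)) (fun i j => (N i j : ℝ)) := by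
  have hn' : ∀ i, (0 : ℝ) < n i := fun i => by exact_mod_cast hn i
  have hN' : ∀ i j, (0 : ℝ) < N i j := fun i j => by exact_mod_cast hN i j
  have hrow' : ∀ i, ∑ j, (N i j : ℝ) = n i := fun i => by exact_mod_cast hrow i
  have hmem : ∀ θ : Param K, θ ∈ restrictedSpace S ↔
      ∀ j j', blk j = blk j' → theta12 θ 0 j = theta12 θ 0 j' := fun θ =>
    (mem_restrictedSpace_iff S θ).trans (hblk _)
  set F := fitted blk (fun i => (n i : ℝ)) (fun i j => (N i j : ℝ)) with hF
  obtain ⟨θ', hfit, h12⟩ := exists_condProb_eq F (fitted_pos hn' hN') (sum_fitted hn' hN' hrow')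
  have hθ' : ∀ j j', blk j = blk j' → theta12 θ' 0 j = theta12 θ' 0 j' := by
    have hratio : ∀ j, F 0 j / F 1 j =
        blockSum blk (fun l => (N 0 l : ℝ)) (blk j) * n 1 /
          (n 0 * blockSum blk (fun l => (N 1 l : ℝ)) (blk j)) := by
      intro j
      have h0 := blockSum_pos (blk := blk) (hN' 0) j
      have h1 := blockSum_pos (blk := blk) (hN' 1) j
      have h2 := blockSum_pos (blk := blk) (fun l => add_pos (hN' 0 l) (hN' 1 l)) j
      have := hn' 0; have := hn' 1; have := hN' 0 j; have := hN' 1 j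
      simp only [hF, fitted]
      field_simp
    intro j j' hj
    rw [h12, h12, hratio j, hratio j', hj]
  have hkl : ∀ θ ∈ restrictedSpace S, ∀ i,
      ∑ j, condProb θ' i j * (Real.log (condProb θ i j) - Real.log (condProb θ' i j)) ≤ 0 ∧
      (0 ≤ ∑ j, condProb θ' i j * (Real.log (condProb θ i j) - Real.log (condProb θ' i j)) →
        condProb θ i = condProb θ' i) := fun θ _ i =>
    eq_of_sum_mul_log_div_nonneg (condProb_pos θ' i) (condProb_pos θ i)
      (by rw [sum_condProb, sum_condProb])
  have hmax : IsMLE n N (restrictedSpace S) θ' := by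
    refine ⟨(hmem θ').2 hθ', fun θ hθ => ?_⟩
    have h1 := logLik_sub_logLik hn hN hrow ((hmem θ).1 hθ) hθ' hfit
    have h2 : ∑ i, (n i : ℝ) * ∑ j, condProb θ' i j *
        (Real.log (condProb θ i j) - Real.log (condProb θ' i j)) ≤ 0 :=
      Finset.sum_nonpos fun i _ =>
        mul_nonpos_of_nonneg_of_nonpos (hn' i).le (hkl θ hθ i).1
    exact sub_nonpos.1 (h1.le.trans h2)
  obtain ⟨hTmem, hTmax⟩ := hT N ⟨θ', hmax⟩
  have h3 : 0 ≤ logLik n N (T N) - logLik n N θ' := sub_nonneg.2 (hTmax hmax.1)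
  rw [logLik_sub_logLik hn hN hrow ((hmem _).1 hTmem) hθ' hfit] at h3
  rw [← hfit]
  funext i
  refine (hkl _ hTmem i).2 ?_
  rw [Fin.sum_univ_two] at h3
  have ha := mul_nonpos_of_nonneg_of_nonpos (hn' 0).le (hkl _ hTmem 0).1
  have hb := mul_nonpos_of_nonneg_of_nonpos (hn' 1).le (hkl _ hTmem 1).1
  refine le_of_mul_le_mul_left ?_ (hn' i)
  rw [mul_zero]
  fin_cases i
  · simp only [Fin.zero_eta]; linarith
  · simp only [Fin.mk_one]; linarith

/-! ### Reduction of divergence statistics to Pearson's statistic -/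

/-- Pearson's chi-squared statistic `t ∑ (p - q)² / q`. -/
noncomputable def pearson {ι : Type*} [Fintype ι] (t : ℝ) (p q : Fin 2 → ι → ℝ) : ℝ :=
  ∑ i, ∑ j, q i j * (t * (p i j / q i j - 1) ^ 2)

section divergence

variable {α : Type*} {l : Filter α} {t : α → ℝ}

/-- Every `φ`-divergence statistic is asymptotically Pearson's statistic. -/
theorem tendsto_phiDiv_sub_pearson {K : ℕ} {φ : ℝ → ℝ} (hφ : IsDivergenceFunction φ)
    {p q : α → Fin 2 → Fin (K + 1) → ℝ} (ht : Tendsto t l atTop)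
    (hq : ∀ i j, (fun a => q a i j) =O[l] fun _ => (1 : ℝ))
    (hpq : ∀ i j, (fun a => √(t a) * (p a i j / q a i j - 1)) =O[l] fun _ => (1 : ℝ)) :
    Tendsto (fun a => 2 * t a / deriv (deriv φ) 1 * phiDiv φ (p a) (q a) -
      pearson (t a) (p a) (q a)) l (𝓝 0) := by
  set c := deriv (deriv φ) 1 with hc
  have hcpos : 0 < c := hφ.deriv2_one_pos
  have h1 : Tendsto (fun a => ∑ i, ∑ j, q a i j * (2 / c *
      (t a * (φ (p a i j / q a i j) - c / 2 * (p a i j / q a i j - 1) ^ 2)))) l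
      (𝓝 (∑ _i : Fin 2, ∑ _j : Fin (K + 1), 0)) := by
    refine tendsto_finsetSum _ fun i _ => tendsto_finsetSum _ fun j _ => ?_
    refine tendsto_zero_of_isBigO_one_mul (hq i j) ?_
    simpa using (hφ.tendsto_mul_sub_sq ht (hpq i j)).const_mul (2 / c)
  simp only [Finset.sum_const_zero] at h1
  refine h1.congr fun a => ?_
  simp only [phiDiv, pearson, Finset.mul_sum, ← Finset.sum_sub_distrib]
  refine Finset.sum_congr rfl fun i _ => Finset.sum_congr rfl fun j _ => ?_
  field_simp

variable {K : ℕ} {p q r : α → Fin 2 → Fin (K + 1) → ℝ}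

/-- Closeness to `1` at rate `1/√t` is inherited by quotients. -/
theorem isBigO_sqrt_mul_div_sub_one {ρ σ : α → ℝ} (ht : Tendsto t l atTop)
    (hρ : (fun a => √(t a) * (ρ a - 1)) =O[l] fun _ => (1 : ℝ))
    (hσ : (fun a => √(t a) * (σ a - 1)) =O[l] fun _ => (1 : ℝ)) :
    (fun a => √(t a) * (σ a / ρ a - 1)) =O[l] fun _ => (1 : ℝ) := by
  have hρ1 := tendsto_one_of_isBigO_sqrt_mul_sub ht hρ
  refine (isBigO_one_mul (hσ.sub hρ) ((hρ1.inv₀ one_ne_zero).isBigO_one ℝ)).congr' ?_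
    EventuallyEq.rfl
  filter_upwards [hρ1.eventually_ne one_ne_zero] with a ha
  field_simp
  ring

/-- Asymptotic Pythagorean identity for Pearson's statistic. -/
theorem tendsto_pearson_pythagoras (ht : Tendsto t l atTop)
    (hq : ∀ i j, (fun a => q a i j) =O[l] fun _ => (1 : ℝ))
    (hqpos : ∀ᶠ a in l, ∀ i j, 0 < q a i j)
    (hpq : ∀ i j, (fun a => √(t a) * (p a i j / q a i j - 1)) =O[l] fun _ => (1 : ℝ))
    (hrq : ∀ i j, (fun a => √(t a) * (r a i j / q a i j - 1)) =O[l] fun _ => (1 : ℝ))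
    (horth : ∀ᶠ a in l, ∑ i, ∑ j, (r a i j - p a i j) * (p a i j / q a i j - 1) = 0) :
    Tendsto (fun a => pearson (t a) (r a) (q a) - pearson (t a) (r a) (p a) -
      pearson (t a) (p a) (q a)) l (𝓝 0) := by
  have hρ1 : ∀ i j, Tendsto (fun a => p a i j / q a i j) l (𝓝 1) := fun i j =>
    tendsto_one_of_isBigO_sqrt_mul_sub ht (hpq i j)
  have h1 : Tendsto (fun a => ∑ i, ∑ j, (q a i j *
      ((√(t a) * (r a i j / q a i j - 1) - √(t a) * (p a i j / q a i j - 1)) *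
        (√(t a) * (r a i j / q a i j - 1) - √(t a) * (p a i j / q a i j - 1)))) *
        (1 - (p a i j / q a i j)⁻¹)) l
      (𝓝 (∑ _i : Fin 2, ∑ _j : Fin (K + 1), 0)) := by
    refine tendsto_finsetSum _ fun i _ => tendsto_finsetSum _ fun j _ => ?_
    have hd := (hrq i j).sub (hpq i j)
    refine tendsto_zero_of_isBigO_one_mul
      (isBigO_one_mul (hq i j) (isBigO_one_mul hd hd)) ?_
    simpa using ((hρ1 i j).inv₀ one_ne_zero).const_sub 1
  simp only [Finset.sum_const_zero] at h1
  refine h1.congr' ?_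
  have hρpos : ∀ᶠ a in l, ∀ i j, 0 < p a i j / q a i j :=
    eventually_all.2 fun i => eventually_all.2 fun j =>
      (hρ1 i j).eventually_const_lt one_pos
  filter_upwards [ht.eventually_gt_atTop 0, hqpos, hρpos, horth] with a hta hqa hρa ho
  have h2 : √(t a) * √(t a) = t a := Real.mul_self_sqrt hta.le
  -- Subtracting the vanishing cross term makes the identity hold entry by entry.
  have h3 : pearson (t a) (r a) (q a) - pearson (t a) (r a) (p a) - pearson (t a) (p a) (q a) =
      pearson (t a) (r a) (q a) - pearson (t a) (r a) (p a) - pearson (t a) (p a) (q a) -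
        2 * t a * ∑ i, ∑ j, (r a i j - p a i j) * (p a i j / q a i j - 1) := by
    rw [ho]; ring
  rw [h3]
  simp only [pearson, Finset.mul_sum, ← Finset.sum_sub_distrib]
  refine Finset.sum_congr rfl fun i _ => Finset.sum_congr rfl fun j _ => ?_
  have hq' := hqa i j
  have hp' : 0 < p a i j := (div_pos_iff_of_pos_right hq').1 (hρa i j)
  rw [← mul_sub, show ∀ x y : ℝ, x * y * (x * y) = x * x * (y * y) by intros; ring, h2]
  field_simp
  ring

/-- The statistics `S_φ` and `T_φ` are both asymptotically equal to Pearson's statistic. -/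
theorem tendsto_statS_statT_sub_pearson {φ : ℝ → ℝ} (hφ : IsDivergenceFunction φ)
    {n : α → Fin 2 → ℕ} (ht : Tendsto (fun a => total (n a)) l atTop)
    (hq : ∀ i j, (fun a => q a i j) =O[l] fun _ => (1 : ℝ))
    (hqpos : ∀ᶠ a in l, ∀ i j, 0 < q a i j)
    (hpq : ∀ i j, (fun a => √(total (n a)) * (p a i j / q a i j - 1)) =O[l] fun _ => (1 : ℝ))
    (hrq : ∀ i j, (fun a => √(total (n a)) * (r a i j / q a i j - 1)) =O[l] fun _ => (1 : ℝ))
    (horth : ∀ᶠ a in l, ∑ i, ∑ j, (r a i j - p a i j) * (p a i j / q a i j - 1) = 0) :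
    Tendsto (fun a => statS φ (n a) (p a) (q a) - pearson (total (n a)) (p a) (q a)) l (𝓝 0) ∧
      Tendsto (fun a => statT φ (n a) (r a) (p a) (q a) -
        pearson (total (n a)) (p a) (q a)) l (𝓝 0) := by
  refine ⟨tendsto_phiDiv_sub_pearson hφ ht hq hpq, ?_⟩
  have hρ1 : ∀ i j, Tendsto (fun a => p a i j / q a i j) l (𝓝 1) := fun i j =>
    tendsto_one_of_isBigO_sqrt_mul_sub ht (hpq i j)
  have hp : ∀ i j, (fun a => p a i j) =O[l] fun _ => (1 : ℝ) := fun i j => by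
    refine (isBigO_one_mul ((hρ1 i j).isBigO_one ℝ) (hq i j)).congr' ?_ EventuallyEq.rfl
    filter_upwards [hqpos] with a ha
    exact div_mul_cancel₀ _ (ha i j).ne'
  have hrp : ∀ i j, (fun a => √(total (n a)) * (r a i j / p a i j - 1)) =O[l]
      fun _ => (1 : ℝ) := fun i j => by
    refine (isBigO_sqrt_mul_div_sub_one ht (hpq i j) (hrq i j)).congr' ?_ EventuallyEq.rfl
    filter_upwards [hqpos] with a ha
    rw [div_div_div_cancel_right₀ (ha i j).ne']
  have h1 := tendsto_phiDiv_sub_pearson hφ ht hq hrq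
  have h2 := tendsto_phiDiv_sub_pearson hφ ht hp hrp
  have h3 := tendsto_pearson_pythagoras ht hq hqpos hpq hrq horth
  have h4 := (h1.sub h2).add h3
  simp only [sub_zero, add_zero] at h4
  refine h4.congr fun a => ?_
  unfold statT
  ring

end divergence

/-! ### Block scores and regular tables -/

/-- The score for the block `b`: the difference of the relative frequencies of `b` in the two
samples, multiplied by `√(n₁ n₂ / n)`, written in terms of the standardized deviations of the
two block counts from their expectations.  Here `w` is the common probability vector. -/
noncomputable def blockScore {ι β : Type*} [Fintype ι] [DecidableEq β] (blk : ι → β)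
    (n : Fin 2 → ℝ) (N : Fin 2 → ι → ℝ) (w : ι → ℝ) (b : β) : ℝ :=
  √(n 0 / (n 0 + n 1) * (n 1 / (n 0 + n 1))) *
    ((blockSum blk (N 0) b - n 0 * blockSum blk w b) / √(n 0 + n 1) / (n 0 / (n 0 + n 1)) -
      (blockSum blk (N 1) b - n 1 * blockSum blk w b) / √(n 0 + n 1) / (n 1 / (n 0 + n 1)))

/-- The only linear relation between the block scores. -/
theorem sum_blockScore {ι β : Type*} [Fintype ι] [Fintype β] [DecidableEq β] (blk : ι → β)
    {n : Fin 2 → ℝ} {N : Fin 2 → ι → ℝ} {w : ι → ℝ} (hrow : ∀ i, ∑ j, N i j = n i)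
    (hw : ∑ j, w j = 1) : ∑ b, blockScore blk n N w b = 0 := by
  simp only [blockScore, ← Finset.mul_sum, Finset.sum_sub_distrib, ← Finset.sum_div,
    sum_blockSum, hrow, hw]
  simp

/-- A sequence (or net) of tables with two rows whose row sizes `n_i` are of the same order and
whose entries deviate from `n_i w_j` by `O(√(n₁ + n₂))`. -/
structure IsRegularTable {α ι : Type*} [Fintype ι] (l : Filter α) (n : α → Fin 2 → ℝ)
    (N : α → Fin 2 → ι → ℝ) (w : ι → ℝ) (ν : Fin 2 → ℝ) : Prop where
  tendsto_total : Tendsto (fun a => n a 0 + n a 1) l atTop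
  ratio_pos : ∀ i, 0 < ν i
  tendsto_ratio : ∀ i, Tendsto (fun a => n a i / (n a 0 + n a 1)) l (𝓝 (ν i))
  prob_pos : ∀ j, 0 < w j
  isBigO_dev : ∀ i j, (fun a => (N a i j - n a i * w j) / √(n a 0 + n a 1)) =O[l]
    fun _ => (1 : ℝ)
  row_sum : ∀ᶠ a in l, ∀ i, ∑ j, N a i j = n a i

namespace IsRegularTable

variable {α : Type*} {l : Filter α} {ι : Type*} [Fintype ι] {n : α → Fin 2 → ℝ}
  {N : α → Fin 2 → ι → ℝ} {w : ι → ℝ} {ν : Fin 2 → ℝ}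

theorem eventually_size_pos (h : IsRegularTable l n N w ν) : ∀ᶠ a in l, ∀ i, 0 < n a i := by
  refine eventually_all.2 fun i => ?_
  filter_upwards [h.tendsto_total.eventually_gt_atTop 0,
    (h.tendsto_ratio i).eventually_const_lt (h.ratio_pos i)] with a h1 h2
  exact (div_pos_iff_of_pos_right h1).1 h2

theorem eventually_count_pos (h : IsRegularTable l n N w ν) :
    ∀ᶠ a in l, ∀ i j, 0 < N a i j := by
  refine eventually_all.2 fun i => eventually_all.2 fun j => ?_
  filter_upwards [h.tendsto_total.eventually_gt_atTop 0,
    (tendsto_count_div h.tendsto_total (h.tendsto_ratio i) (h.isBigO_dev i j)).eventually_const_lt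
      (mul_pos (h.ratio_pos i) (h.prob_pos j))] with a h1 h2
  exact (div_pos_iff_of_pos_right h1).1 h2

theorem ratio_sum [l.NeBot] (h : IsRegularTable l n N w ν) : ν 0 + ν 1 = 1 := by
  refine tendsto_nhds_unique ((h.tendsto_ratio 0).add (h.tendsto_ratio 1)) ?_
  refine tendsto_const_nhds.congr' ?_
  filter_upwards [h.tendsto_total.eventually_gt_atTop 0] with a ha
  field_simp

variable {β : Type*} [DecidableEq β] {blk : ι → β}

/-- Collapsing categories to blocks preserves regularity. -/
theorem isBigO_dev_blockSum (h : IsRegularTable l n N w ν) (blk : ι → β) (i : Fin 2) (b : β) :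
    (fun a => (blockSum blk (N a i) b - n a i * blockSum blk w b) / √(n a 0 + n a 1)) =O[l]
      fun _ => (1 : ℝ) := by
  have := IsBigO.sum (s := Finset.univ.filter fun j => blk j = b)
    (fun j _ => h.isBigO_dev i j)
  refine this.congr_left fun a => ?_
  rw [Finset.sum_apply, blockSum, blockSum, Finset.mul_sum, ← Finset.sum_sub_distrib,
    Finset.sum_div]

/-- The ratio of a block count to its value fitted under homogeneity is `1 + O(1/√t)`. -/
theorem isBigO_ratio (h : IsRegularTable l n N w ν) (hblk : Function.Surjective blk) (i : Fin 2)
    (b : β) :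
    (fun a => √(n a 0 + n a 1) * (blockSum blk (N a i) b * (n a 0 + n a 1) /
      (n a i * blockSum blk (fun j => N a 0 j + N a 1 j) b) - 1)) =O[l] fun _ => (1 : ℝ) := by
  obtain ⟨j, rfl⟩ := hblk b
  have hw := blockSum_pos (blk := blk) h.prob_pos j
  simp only [blockSum_add]
  fin_cases i
  · exact isBigO_sqrt_mul_count_ratio hw (h.ratio_pos 0) (h.ratio_pos 1) h.tendsto_total
      (fun _ => rfl) (h.tendsto_ratio 0) (h.tendsto_ratio 1) (h.isBigO_dev_blockSum blk 0 _)
      (h.isBigO_dev_blockSum blk 1 _)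
  · refine (isBigO_sqrt_mul_count_ratio hw (h.ratio_pos 1) (h.ratio_pos 0) h.tendsto_total
      (fun _ => add_comm _ _) (h.tendsto_ratio 1) (h.tendsto_ratio 0)
      (h.isBigO_dev_blockSum blk 1 _) (h.isBigO_dev_blockSum blk 0 _)).congr_left fun a => ?_
    simp only [Fin.mk_one]
    rw [add_comm (blockSum blk (N a 1) (blk j))]

theorem tendsto_pooled_div [l.NeBot] (h : IsRegularTable l n N w ν) (blk : ι → β) (b : β) :
    Tendsto (fun a => blockSum blk (fun j => N a 0 j + N a 1 j) b / (n a 0 + n a 1)) l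
      (𝓝 (blockSum blk w b)) := by
  have h0 := tendsto_count_div h.tendsto_total (h.tendsto_ratio 0) (h.isBigO_dev_blockSum blk 0 b)
  have h1 := tendsto_count_div h.tendsto_total (h.tendsto_ratio 1) (h.isBigO_dev_blockSum blk 1 b)
  have h2 := h0.add h1
  rw [← add_mul, h.ratio_sum, one_mul] at h2
  refine h2.congr fun a => ?_
  rw [blockSum_add, add_div]

theorem isBigO_blockScore (h : IsRegularTable l n N w ν) (blk : ι → β) (b : β) :
    (fun a => blockScore blk (n a) (N a) w b) =O[l] fun _ => (1 : ℝ) := by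
  have h1 := ((h.tendsto_ratio 0).mul (h.tendsto_ratio 1)).sqrt.isBigO_one ℝ
  have h2 := fun i => ((h.tendsto_ratio i).inv₀ (h.ratio_pos i).ne').isBigO_one ℝ
  exact isBigO_one_mul h1 ((isBigO_one_mul (h.isBigO_dev_blockSum blk 0 b) (h2 0)).sub
    (isBigO_one_mul (h.isBigO_dev_blockSum blk 1 b) (h2 1)))

/-- Pearson's statistic for homogeneity of the table collapsed to blocks is asymptotically a
weighted sum of squares of the block scores. -/
theorem tendsto_pearson_sub_sum_sq [l.NeBot] [Fintype β] (h : IsRegularTable l n N w ν)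
    (hblk : Function.Surjective blk) {p q : α → Fin 2 → ι → ℝ}
    (hq : ∀ᶠ a in l, ∀ i j, q a i j =
      n a i / (n a 0 + n a 1) * ((N a 0 j + N a 1 j) / (n a 0 + n a 1)))
    (hpq : ∀ᶠ a in l, ∀ i j, p a i j / q a i j = blockSum blk (N a i) (blk j) *
      (n a 0 + n a 1) / (n a i * blockSum blk (fun j => N a 0 j + N a 1 j) (blk j))) :
    Tendsto (fun a => pearson (n a 0 + n a 1) (p a) (q a) -
      ∑ b, blockScore blk (n a) (N a) w b ^ 2 / blockSum blk w b) l (𝓝 0) := by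
  have hwpos : ∀ b, 0 < blockSum blk w b := fun b => by
    obtain ⟨j, rfl⟩ := hblk b
    exact blockSum_pos h.prob_pos j
  have h1 : Tendsto (fun a => ∑ b, blockScore blk (n a) (N a) w b *
      blockScore blk (n a) (N a) w b *
        ((blockSum blk (fun j => N a 0 j + N a 1 j) b / (n a 0 + n a 1))⁻¹ -
          (blockSum blk w b)⁻¹)) l (𝓝 (∑ _b : β, 0)) := by
    refine tendsto_finsetSum _ fun b _ => ?_
    refine tendsto_zero_of_isBigO_one_mul
      (isBigO_one_mul (h.isBigO_blockScore blk b) (h.isBigO_blockScore blk b)) ?_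
    simpa using ((h.tendsto_pooled_div blk b).inv₀ (hwpos b).ne').sub_const (blockSum blk w b)⁻¹
  simp only [Finset.sum_const_zero] at h1
  refine h1.congr' ?_
  filter_upwards [hq, hpq, h.eventually_size_pos, h.eventually_count_pos] with a hqa hpqa hn hN
  have hpear : pearson (n a 0 + n a 1) (p a) (q a) =
      ∑ b, blockScore blk (n a) (N a) w b ^ 2 /
        (blockSum blk (fun j => N a 0 j + N a 1 j) b / (n a 0 + n a 1)) := by
    have h0 := hn 0
    have h1 := hn 1
    have hstep : ∀ i, ∑ j, q a i j * ((n a 0 + n a 1) * (p a i j / q a i j - 1) ^ 2) =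
        ∑ b, blockSum blk (fun j => N a 0 j + N a 1 j) b * (n a i / (n a 0 + n a 1) *
          (blockSum blk (N a i) b * (n a 0 + n a 1) /
          (n a i * blockSum blk (fun j => N a 0 j + N a 1 j) b) - 1) ^ 2) := by
      intro i
      rw [← sum_mul_comp_eq_sum_blockSum_mul blk (fun j => N a 0 j + N a 1 j)
        (fun b => n a i / (n a 0 + n a 1) * (blockSum blk (N a i) b * (n a 0 + n a 1) /
          (n a i * blockSum blk (fun j => N a 0 j + N a 1 j) b) - 1) ^ 2)]
      refine Finset.sum_congr rfl fun j _ => ?_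
      rw [hpqa, hqa]
      generalize (blockSum blk (N a i) (blk j) * (n a 0 + n a 1) /
        (n a i * blockSum blk (fun j => N a 0 j + N a 1 j) (blk j)) - 1) ^ 2 = X
      field_simp
    rw [pearson, Finset.sum_congr rfl fun i _ => hstep i, Fin.sum_univ_two,
      ← Finset.sum_add_distrib]
    refine Finset.sum_congr rfl fun b _ => ?_
    obtain ⟨j, rfl⟩ := hblk b
    have hb0 := blockSum_pos (blk := blk) (hN 0) j
    have hb1 := blockSum_pos (blk := blk) (hN 1) j
    rw [blockScore, mul_pow, Real.sq_sqrt (by positivity), blockSum_add]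
    have hs : √(n a 0 + n a 1) ^ 2 = n a 0 + n a 1 := Real.sq_sqrt (by positivity)
    have hs0 : 0 < √(n a 0 + n a 1) := Real.sqrt_pos.2 (by positivity)
    rw [show ∀ x y : ℝ, x / √(n a 0 + n a 1) / (n a 0 / (n a 0 + n a 1)) -
      y / √(n a 0 + n a 1) / (n a 1 / (n a 0 + n a 1)) =
      (x / (n a 0 / (n a 0 + n a 1)) - y / (n a 1 / (n a 0 + n a 1))) / √(n a 0 + n a 1) by
        intros; field_simp, div_pow, hs]
    field_simp
    ring
  rw [hpear, ← Finset.sum_sub_distrib]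
  refine Finset.sum_congr rfl fun b _ => ?_
  rw [mul_sub, ← pow_two, ← div_eq_mul_inv, ← div_eq_mul_inv]

end IsRegularTable

/-! ### Asymptotics of the test statistics along regular tables -/

theorem blockSum_id {ι : Type*} [Fintype ι] [DecidableEq ι] (f : ι → ℝ) (j : ι) :
    blockSum id f j = f j := by
  simp [blockSum, Finset.filter_eq']

theorem forall_mem_univ_castSucc_eq_succ_iff {K : ℕ} (f : Fin (K + 1) → ℝ) :
    (∀ h ∈ (Finset.univ : Finset (Fin K)), f h.castSucc = f h.succ) ↔
      ∀ j j', (fun _ => () : Fin (K + 1) → Unit) j = (fun _ => ()) j' → f j = f j' := by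
  refine ⟨fun h => ?_, fun h k _ => h _ _ rfl⟩
  have h0 : ∀ j, f j = f 0 := fun j => by
    induction j using Fin.induction with
    | zero => rfl
    | succ k ih => rw [← h k (Finset.mem_univ k), ih]
  intro j j' _
  rw [h0 j, h0 j']

/-- Under the null hypothesis the model collapses to a single block, and the fitted distribution
is the vector of pooled relative frequencies. -/
theorem fitted_unit {J : ℕ} {n : Fin 2 → ℝ} {N : Fin 2 → Fin J → ℝ} (hn : ∀ i, 0 < n i)
    (hrow : ∀ i, ∑ j, N i j = n i) (i : Fin 2) (j : Fin J) :
    fitted (fun _ => ()) n N i j = (N 0 j + N 1 j) / (n 0 + n 1) := by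
  have h1 := hn i
  have h2 : 0 < n 0 + n 1 := add_pos (hn 0) (hn 1)
  simp only [fitted, blockSum, Finset.filter_true, Finset.sum_add_distrib, hrow]
  field_simp

/-- Deterministic form of the theorem: along tables whose entries deviate from their expectations
by `O(√n)`, both statistics are asymptotically equal to the same weighted sum of squares of the
block scores. -/
theorem tendsto_testS_testT_sub {K : ℕ} {S : Finset (Fin K)} {β : Type*} [Fintype β]
    [DecidableEq β] {blk : Fin (K + 1) → β} (hsurj : Function.Surjective blk)
    (hblk : ∀ f : Fin (K + 1) → ℝ, (∀ h ∈ S, f h.castSucc = f h.succ) ↔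
        ∀ j j', blk j = blk j' → f j = f j')
    {φ : ℝ → ℝ} (hφ : IsDivergenceFunction φ) {α : Type*} {l : Filter α}
    {n : α → Fin 2 → ℕ} {N : α → Fin 2 → Fin (K + 1) → ℕ} {w : Fin (K + 1) → ℝ} {ν : Fin 2 → ℝ}
    (h : IsRegularTable l (fun a i => (n a i : ℝ)) (fun a i j => (N a i j : ℝ)) w ν)
    {θhat θhatS : α → (Fin 2 → Fin (K + 1) → ℕ) → Param K}
    (hθhat : ∀ a, IsMLEstimator (n a) (nullSpace K) (θhat a))
    (hθhatS : ∀ a, IsMLEstimator (n a) (restrictedSpace S) (θhatS a)) :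
    Tendsto (fun a => testS φ (n a) (θhatS a) (θhat a) (N a) -
        ∑ b, blockScore blk (fun i => (n a i : ℝ)) (fun i j => (N a i j : ℝ)) w b ^ 2 /
          blockSum blk w b) l (𝓝 0) ∧
      Tendsto (fun a => testT φ (n a) (θhatS a) (θhat a) (N a) -
        ∑ b, blockScore blk (fun i => (n a i : ℝ)) (fun i j => (N a i j : ℝ)) w b ^ 2 /
          blockSum blk w b) l (𝓝 0) := by
  -- The trivial filter occurs in applications, when no table satisfies a prescribed bound.
  rcases l.eq_or_neBot with rfl | _
  · simp
  simp only [testS, testT]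
  set p : α → Fin 2 → Fin (K + 1) → ℝ := fun a => cellProb (n a) (θhatS a (N a))
  set q : α → Fin 2 → Fin (K + 1) → ℝ := fun a => cellProb (n a) (θhat a (N a))
  have hq_eq : ∀ᶠ a in l, ∀ i j, q a i j = (n a i : ℝ) / (n a 0 + n a 1) *
      (((N a 0 j : ℝ) + N a 1 j) / (n a 0 + n a 1)) := by
    filter_upwards [h.eventually_size_pos, h.eventually_count_pos, h.row_sum] with a hn hN hrow i j
    have hest : IsMLEstimator (n a) (restrictedSpace Finset.univ) (θhat a) :=
      nullSpace_eq_restrictedSpace_univ K ▸ hθhat a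
    have hn' : ∀ i, 0 < n a i := fun i => by exact_mod_cast hn i
    change cellProb (n a) (θhat a (N a)) i j = _
    rw [cellProb_eq _ hn', condProb_mlEstimator forall_mem_univ_castSucc_eq_succ_iff hn'
      (fun i j => by exact_mod_cast hN i j) (fun i => by exact_mod_cast hrow i) hest,
      fitted_unit hn hrow]
    rfl
  have hp_eq : ∀ᶠ a in l, ∀ i j, p a i j = (n a i : ℝ) / (n a 0 + n a 1) *
      fitted blk (fun i => (n a i : ℝ)) (fun i j => (N a i j : ℝ)) i j := by
    filter_upwards [h.eventually_size_pos, h.eventually_count_pos, h.row_sum] with a hn hN hrow i j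
    have hn' : ∀ i, 0 < n a i := fun i => by exact_mod_cast hn i
    change cellProb (n a) (θhatS a (N a)) i j = _
    rw [cellProb_eq _ hn', condProb_mlEstimator hblk hn'
      (fun i j => by exact_mod_cast hN i j) (fun i => by exact_mod_cast hrow i) (hθhatS a)]
    rfl
  have hpq_eq : ∀ᶠ a in l, ∀ i j, p a i j / q a i j =
      blockSum blk (fun j => (N a i j : ℝ)) (blk j) * (n a 0 + n a 1) /
        (n a i * blockSum blk (fun j => (N a 0 j : ℝ) + N a 1 j) (blk j)) := by
    filter_upwards [h.eventually_size_pos, h.eventually_count_pos, hq_eq, hp_eq]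
      with a hn hN hqa hpa i j
    have h2 := blockSum_pos (blk := blk) (fun l => add_pos (hN 0 l) (hN 1 l)) j
    have h3 : 0 < (n a 0 : ℝ) + n a 1 := add_pos (hn 0) (hn 1)
    have h4 := hn i
    have h5 := add_pos (hN 0 j) (hN 1 j)
    rw [hqa, hpa, fitted]
    field_simp
  have hrq_eq : ∀ᶠ a in l, ∀ i j, relFreq (n a) (N a) i j / q a i j =
      blockSum id (fun j => (N a i j : ℝ)) j * (n a 0 + n a 1) /
        (n a i * blockSum id (fun j => (N a 0 j : ℝ) + N a 1 j) j) := by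
    filter_upwards [h.eventually_size_pos, h.eventually_count_pos, hq_eq] with a hn hN hqa i j
    have h3 : 0 < (n a 0 : ℝ) + n a 1 := add_pos (hn 0) (hn 1)
    have h4 := hn i
    have h5 := add_pos (hN 0 j) (hN 1 j)
    rw [hqa, blockSum_id, blockSum_id, relFreq, total]
    field_simp
  have hqO : ∀ i j, (fun a => q a i j) =O[l] fun _ => (1 : ℝ) := fun i j => by
    refine (((h.tendsto_ratio i).mul (h.tendsto_pooled_div id j)).isBigO_one ℝ).congr' ?_
      EventuallyEq.rfl
    filter_upwards [hq_eq] with a ha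
    rw [ha, blockSum_id]
  have hqpos : ∀ᶠ a in l, ∀ i j, 0 < q a i j := .of_forall fun a i j => cellProb_pos _ _ _ _
  have hpqO : ∀ i j, (fun a => √(total (n a)) * (p a i j / q a i j - 1)) =O[l]
      fun _ => (1 : ℝ) := fun i j => by
    refine (h.isBigO_ratio hsurj i (blk j)).congr' ?_ EventuallyEq.rfl
    filter_upwards [hpq_eq] with a ha
    rw [ha, total]
  have hrqO : ∀ i j, (fun a => √(total (n a)) * (relFreq (n a) (N a) i j / q a i j - 1)) =O[l]
      fun _ => (1 : ℝ) := fun i j => by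
    refine (h.isBigO_ratio Function.surjective_id i j).congr' ?_ EventuallyEq.rfl
    filter_upwards [hrq_eq] with a ha
    rw [ha, total]
  -- `p / q` is constant on blocks, and `r` and `p` give the same mass to each block.
  have horth : ∀ᶠ a in l, ∑ i, ∑ j, (relFreq (n a) (N a) i j - p a i j) *
      (p a i j / q a i j - 1) = 0 := by
    filter_upwards [h.eventually_size_pos, h.eventually_count_pos, hp_eq, hpq_eq]
      with a hn hN hpa hpqa
    refine Finset.sum_eq_zero fun i _ => ?_
    simp only [hpqa]
    rw [sum_mul_comp_eq_sum_blockSum_mul blk (fun j => relFreq (n a) (N a) i j - p a i j)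
      (fun b => blockSum blk (fun j => (N a i j : ℝ)) b * (n a 0 + n a 1) /
        (n a i * blockSum blk (fun j => (N a 0 j : ℝ) + N a 1 j) b) - 1)]
    refine Finset.sum_eq_zero fun b _ => ?_
    refine mul_eq_zero_of_left ?_ _
    have h6 := blockSum_mul_fitted (blk := blk) hn hN i b
    simp only [blockSum] at h6 ⊢
    rw [Finset.sum_sub_distrib]
    simp only [hpa, relFreq, total, div_mul_eq_mul_div]
    rw [← Finset.sum_div, ← Finset.sum_div, h6, sub_self]
  obtain ⟨hS, hT⟩ := tendsto_statS_statT_sub_pearson hφ h.tendsto_total hqO hqpos hpqO hrqO horth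
  have hpear := h.tendsto_pearson_sub_sum_sq hsurj hq_eq hpq_eq
  constructor
  · simpa [total] using hS.add hpear
  · simpa [total] using hT.add hpear

/-! ### Characteristic functions of multinomial counts -/

open Complex in
/-- Version of `(1 + z) ^ k → exp c` for a net of exponents. -/
theorem tendsto_one_add_pow_exp_of_tendsto_mul {α : Type*} {l : Filter α} {k : α → ℕ} {z : α → ℂ}
    {c : ℂ} (hz : Tendsto z l (𝓝 0)) (hkz : Tendsto (fun a => (k a : ℂ) * z a) l (𝓝 c)) :
    Tendsto (fun a => (1 + z a) ^ k a) l (𝓝 (exp c)) := by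
  have h1 : (fun a => (k a : ℂ) * (log (1 + z a) - z a)) =O[l] fun a => (k a : ℂ) * z a * z a := by
    refine ((isBigO_refl (fun a => (k a : ℂ)) l).mul
      (log_sub_self_isBigO.comp_tendsto hz)).congr_right fun a => ?_
    simp only [Function.comp_apply]
    ring
  have h2 : Tendsto (fun a => (k a : ℂ) * (log (1 + z a) - z a)) l (𝓝 0) :=
    h1.trans_tendsto (by simpa using hkz.mul hz)
  have h3 : Tendsto (fun a => exp ((k a : ℂ) * log (1 + z a))) l (𝓝 (exp c)) := by
    refine (continuous_exp.tendsto c).comp ?_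
    have := h2.add hkz
    rw [zero_add] at this
    exact this.congr fun a => by ring
  refine h3.congr' ?_
  have h4 : ∀ᶠ a in l, 1 + z a ≠ 0 := by
    have : Tendsto (fun a => 1 + z a) l (𝓝 1) := by simpa using hz.const_add 1
    exact this.eventually_ne one_ne_zero
  filter_upwards [h4] with a ha
  rw [exp_nat_mul, exp_log ha]

open Complex in
/-- Second order expansion of the characteristic function of a centred finite distribution. -/
theorem tendsto_mul_sum_exp_sub_one {α ι : Type*} [Fintype ι] {l : Filter α} {t : α → ℝ}
    (ht : Tendsto t l atTop) {w : ι → ℝ} {d : α → ι → ℝ} {d' : ι → ℝ}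
    (hw : ∑ j, w j = 1) (hd0 : ∀ a, ∑ j, w j * d a j = 0)
    (hd : ∀ j, Tendsto (fun a => d a j) l (𝓝 (d' j))) :
    Tendsto (fun a => (t a : ℂ) * (∑ j, (w j : ℂ) * exp ((d a j / √(t a) : ℝ) * I) - 1)) l
      (𝓝 ((-(∑ j, w j * d' j ^ 2) / 2 : ℝ) : ℂ)) := by
  have hs : Tendsto (fun a => √(t a)) l atTop := Real.tendsto_sqrt_atTop.comp ht
  have hterm : ∀ j, Tendsto (fun a => (t a : ℂ) * (exp ((d a j / √(t a) : ℝ) * I) - 1 -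
      (d a j / √(t a) : ℝ) * I)) l (𝓝 ((-(d' j ^ 2) / 2 : ℝ) : ℂ)) := by
    intro j
    have hy : Tendsto (fun a => ((d a j / √(t a) : ℝ) : ℂ) * I) l (𝓝 0) := by
      have : Tendsto (fun a => d a j / √(t a)) l (𝓝 0) := (hd j).div_atTop hs
      have := (continuous_ofReal.tendsto 0).comp this
      simpa using this.mul_const I
    have h1 : (fun y : ℂ => exp y - 1 - y - y ^ 2 / 2) =o[𝓝 0] fun y => y ^ 2 := by
      refine (exp_sub_sum_range_succ_isLittleO_pow 2).congr_left fun y => ?_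
      simp [Finset.sum_range_succ, Nat.factorial]
      ring
    have h2 := (isBigO_refl (fun a => (t a : ℂ)) l).mul_isLittleO (h1.comp_tendsto hy)
    have hsq : ∀ᶠ a in l, (t a : ℂ) * (((d a j / √(t a) : ℝ) : ℂ) * I) ^ 2 =
        ((-(d a j) ^ 2 : ℝ) : ℂ) := by
      filter_upwards [ht.eventually_gt_atTop 0] with a ha
      rw [mul_pow, I_sq, ← ofReal_pow, div_pow, Real.sq_sqrt ha.le]
      push_cast
      have : (t a : ℂ) ≠ 0 := by exact_mod_cast ha.ne'
      field_simp
    have hlim : Tendsto (fun a => ((-(d a j) ^ 2 : ℝ) : ℂ)) l (𝓝 ((-(d' j) ^ 2 : ℝ) : ℂ)) :=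
      (continuous_ofReal.tendsto _).comp ((hd j).pow 2).neg
    have hlim2 := hlim.congr' (hsq.mono fun a ha => ha.symm)
    have h3 : Tendsto (fun a => (t a : ℂ) * (exp ((d a j / √(t a) : ℝ) * I) - 1 -
      (d a j / √(t a) : ℝ) * I - ((d a j / √(t a) : ℝ) * I) ^ 2 / 2)) l (𝓝 0) := by
      rw [← isLittleO_one_iff ℂ]
      exact h2.trans_isBigO (hlim2.isBigO_one ℂ)
    have h4 := h3.add (hlim2.div_const 2)
    rw [zero_add] at h4
    convert! h4 using 2
    · ring
    · push_cast; ring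
  have hsum := tendsto_finsetSum Finset.univ fun j _ => (hterm j).const_mul (w j : ℂ)
  refine (hsum.congr fun a => ?_).trans_eq ?_
  · have hw' : ∑ j, (w j : ℂ) = 1 := by exact_mod_cast hw
    have hd' : ∑ j, (w j : ℂ) * (((d a j / √(t a) : ℝ) : ℂ) * I) = 0 := by
      have : ∑ j, (w j : ℂ) * (((d a j / √(t a) : ℝ) : ℂ) * I) =
          ((∑ j, w j * d a j : ℝ) : ℂ) * (I / (√(t a) : ℝ)) := by
        push_cast
        rw [Finset.sum_mul]
        refine Finset.sum_congr rfl fun j _ => ?_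
        ring
      rw [this, hd0]; simp
    calc ∑ j, (w j : ℂ) * ((t a : ℂ) * (exp ((d a j / √(t a) : ℝ) * I) - 1 -
          (d a j / √(t a) : ℝ) * I))
        = (t a : ℂ) * (∑ j, (w j : ℂ) * exp ((d a j / √(t a) : ℝ) * I) - ∑ j, (w j : ℂ) -
          ∑ j, (w j : ℂ) * (((d a j / √(t a) : ℝ) : ℂ) * I)) := by
          rw [← Finset.sum_sub_distrib, ← Finset.sum_sub_distrib, Finset.mul_sum]
          exact Finset.sum_congr rfl fun j _ => by ring
      _ = _ := by rw [hw', hd', sub_zero]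
  · congr 1
    push_cast
    rw [← Finset.sum_neg_distrib, Finset.sum_div]
    exact Finset.sum_congr rfl fun j _ => by ring

open Complex in
/-- Central limit theorem for one sample, in terms of characteristic functions. -/
theorem tendsto_pow_sum_exp {α ι : Type*} [Fintype ι] {l : Filter α} {t : α → ℝ} {k : α → ℕ}
    {ν : ℝ} (ht : Tendsto t l atTop) (hk : Tendsto (fun a => (k a : ℝ) / t a) l (𝓝 ν))
    {w : ι → ℝ} {γ : α → ι → ℝ} {γ' : ι → ℝ} (hw : ∑ j, w j = 1)
    (hγ : ∀ j, Tendsto (fun a => γ a j) l (𝓝 (γ' j))) :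
    Tendsto (fun a => (∑ j, (w j : ℂ) *
        exp (((γ a j - ∑ j, w j * γ a j) / √(t a) : ℝ) * I)) ^ k a) l
      (𝓝 (exp ((-(ν * (∑ j, w j * γ' j ^ 2 - (∑ j, w j * γ' j) ^ 2)) / 2 : ℝ) : ℂ))) := by
  have h1 := tendsto_mul_sum_exp_sub_one (d := fun a j => γ a j - ∑ j, w j * γ a j)
    (d' := fun j => γ' j - ∑ j, w j * γ' j) ht hw
    (fun a => by simp only [mul_sub, Finset.sum_sub_distrib, ← Finset.sum_mul, hw]; simp)
    (fun j => (hγ j).sub (tendsto_finsetSum _ fun j _ => (hγ j).const_mul (w j)))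
  set z : α → ℂ := fun a => ∑ j, (w j : ℂ) *
    exp (((γ a j - ∑ j, w j * γ a j) / √(t a) : ℝ) * I) - 1 with hz
  have hvar : ∑ j, w j * (γ' j - ∑ j, w j * γ' j) ^ 2 =
      ∑ j, w j * γ' j ^ 2 - (∑ j, w j * γ' j) ^ 2 := by
    set s := ∑ j, w j * γ' j with hs
    have : ∀ j, w j * (γ' j - s) ^ 2 = w j * γ' j ^ 2 - 2 * s * (w j * γ' j) + s ^ 2 * w j :=
      fun j => by ring
    simp only [this, Finset.sum_add_distrib, Finset.sum_sub_distrib, ← Finset.mul_sum, hw, ← hs]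
    ring
  rw [hvar] at h1
  replace h1 : Tendsto (fun a => (t a : ℂ) * z a) l _ := h1
  have hkz : Tendsto (fun a => (k a : ℂ) * z a) l
      (𝓝 ((-(ν * (∑ j, w j * γ' j ^ 2 - (∑ j, w j * γ' j) ^ 2)) / 2 : ℝ) : ℂ)) := by
    have h2 := ((continuous_ofReal.tendsto _).comp hk).mul h1
    refine (h2.congr' ?_).trans_eq ?_
    · filter_upwards [ht.eventually_gt_atTop 0] with a ha
      have : (t a : ℂ) ≠ 0 := by exact_mod_cast ha.ne'
      simp only [Function.comp_apply]
      push_cast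
      field_simp
    · congr 1; push_cast; ring
  have hz0 : Tendsto z l (𝓝 0) := by
    have h3 : Tendsto (fun a => ((t a)⁻¹ : ℝ)) l (𝓝 0) := ht.inv_tendsto_atTop
    have h4 := ((continuous_ofReal.tendsto _).comp h3).mul h1
    simp only [ofReal_zero, zero_mul] at h4
    refine h4.congr' ?_
    filter_upwards [ht.eventually_gt_atTop 0] with a ha
    have : (t a : ℂ) ≠ 0 := by exact_mod_cast ha.ne'
    simp only [Function.comp_apply]
    push_cast
    field_simp
  refine (tendsto_one_add_pow_exp_of_tendsto_mul hz0 hkz).congr fun a => ?_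
  simp [hz]

section multinomial

variable {Ω : Type*} [MeasurableSpace Ω] {μ : Measure Ω} [IsProbabilityMeasure μ]

theorem ae_sum_eq_of_multinomial {J : ℕ} {n : ℕ} {π : Fin J → ℝ} {Y : Ω → Fin J → ℕ}
    (hlaw : ∀ k, μ.real {ω | Y ω = k} = multinomialProb n π k) : ∀ᵐ ω ∂μ, ∑ j, Y ω j = n := by
  have h : μ (⋃ k ∈ {k : Fin J → ℕ | ∑ j, k j ≠ n}, {ω | Y ω = k}) = 0 := by
    refine (measure_biUnion_null_iff (Set.to_countable _)).2 fun k hk => ?_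
    have := hlaw k
    rw [multinomialProb, if_neg hk] at this
    exact (measureReal_eq_zero_iff).1 this
  refine measure_mono_null (fun ω hω => ?_) h
  simp only [Set.mem_iUnion]
  exact ⟨Y ω, hω, rfl⟩

open Complex in
/-- The characteristic function of the multinomial distribution, by the multinomial theorem. -/
theorem integral_exp_multinomial {J : ℕ} {n : ℕ} {π : Fin J → ℝ} {Y : Ω → Fin J → ℕ}
    (hY : Measurable Y) (hlaw : ∀ k, μ.real {ω | Y ω = k} = multinomialProb n π k)
    (c : Fin J → ℝ) :
    ∫ ω, exp ((∑ j, c j * Y ω j : ℝ) * I) ∂μ = (∑ j, (π j : ℂ) * exp (c j * I)) ^ n := by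
  classical
  let f : (Fin J → ℕ) → ℂ := fun k => exp ((∑ j, c j * k j : ℝ) * I)
  have hms : ∀ k, MeasurableSet {ω | Y ω = k} := fun k => hY (measurableSet_singleton k)
  have hae : (fun ω => f (Y ω)) =ᵐ[μ] fun ω => ∑ k ∈ Finset.piAntidiag Finset.univ n,
      Set.indicator {ω | Y ω = k} (fun _ => f k) ω := by
    filter_upwards [ae_sum_eq_of_multinomial hlaw] with ω hω
    rw [Finset.sum_eq_single (Y ω)]
    · simp
    · intro k _ hk
      exact Set.indicator_of_notMem (fun h => hk (Eq.symm h)) _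
    · intro h
      exact absurd (by simp [hω]) h
  change ∫ ω, f (Y ω) ∂μ = _
  rw [integral_congr_ae hae, integral_finsetSum _ fun k _ =>
    (integrable_const (f k)).indicator (hms k), Finset.sum_pow_eq_sum_piAntidiag]
  refine Finset.sum_congr rfl fun k hk => ?_
  rw [integral_indicator_const _ (hms k), hlaw, multinomialProb,
    if_pos (by simpa using hk)]
  simp only [f, mul_pow, Finset.prod_mul_distrib, ← exp_nat_mul, ← exp_sum]
  simp only [real_smul]
  push_cast
  rw [mul_assoc, Finset.sum_mul]
  congr 3
  refine Finset.sum_congr rfl fun j _ => ?_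
  ring

end multinomial

open Complex in
/-- **Central limit theorem** for the product-multinomial distribution: convergence of the
characteristic function of a linear form in the standardized deviations of the counts. -/
theorem tendsto_integral_exp_dev {K : ℕ} {ι : Type*} {l : Filter ι} {n : ι → Fin 2 → ℕ}
    (ht : Tendsto (fun m => total (n m)) l atTop) {ν : Fin 2 → ℝ}
    (hnν : ∀ i, Tendsto (fun m => (n m i : ℝ) / total (n m)) l (𝓝 (ν i)))
    {Ω : ι → Type*} [∀ m, MeasurableSpace (Ω m)]
    {μ : (m : ι) → Measure (Ω m)} [∀ m, IsProbabilityMeasure (μ m)]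
    {N : (m : ι) → Ω m → Fin 2 → Fin (K + 1) → ℕ} {w : Fin (K + 1) → ℝ} (hw : ∑ j, w j = 1)
    (hN : ∀ m, IsProductMultinomial (μ m) (n m) (fun _ => w) (N m))
    {γ : ι → Fin 2 → Fin (K + 1) → ℝ} {γ' : Fin 2 → Fin (K + 1) → ℝ}
    (hγ : ∀ i j, Tendsto (fun m => γ m i j) l (𝓝 (γ' i j))) :
    Tendsto (fun m => ∫ ω, exp ((∑ i, ∑ j, γ m i j *
        (((N m ω i j : ℝ) - n m i * w j) / √(total (n m))) : ℝ) * I) ∂μ m) l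
      (𝓝 (exp ((-(∑ i, ν i * (∑ j, w j * γ' i j ^ 2 - (∑ j, w j * γ' i j) ^ 2)) / 2 : ℝ) : ℂ)))
      := by
  have h1 := (tendsto_pow_sum_exp ht (hnν 0) hw (hγ 0)).mul
    (tendsto_pow_sum_exp ht (hnν 1) hw (hγ 1))
  rw [← exp_add] at h1
  refine (h1.congr fun m => ?_).trans_eq ?_
  · have hrow : ∀ i, Measurable fun ω => N m ω i := fun i =>
      (measurable_pi_apply i).comp (hN m).measurable
    -- `f i` is the factor contributed by the `i`-th sample, including its centring constant.
    let c : Fin 2 → Fin (K + 1) → ℝ := fun i j => γ m i j / √(total (n m))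
    let b : Fin 2 → ℝ := fun i => ∑ j, w j * γ m i j
    let f : Fin 2 → (Fin (K + 1) → ℕ) → ℂ := fun i k =>
      exp ((∑ j, c i j * k j : ℝ) * I) * exp ((-(n m i * b i / √(total (n m))) : ℝ) * I)
    have hint : ∀ i, ∫ ω, f i (N m ω i) ∂μ m = (∑ j, (w j : ℂ) *
        exp (((γ m i j - ∑ j, w j * γ m i j) / √(total (n m)) : ℝ) * I)) ^ n m i := by
      intro i
      simp only [f]
      rw [integral_mul_const, integral_exp_multinomial (hrow i) ((hN m).law i)]
      have : exp ((-(n m i * b i / √(total (n m))) : ℝ) * I) =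
          exp ((-(b i / √(total (n m))) : ℝ) * I) ^ n m i := by
        rw [← exp_nat_mul]
        congr 1
        push_cast
        ring
      rw [this, ← mul_pow, Finset.sum_mul]
      congr 1
      refine Finset.sum_congr rfl fun j _ => ?_
      rw [mul_assoc, ← exp_add]
      congr 2
      simp only [c, b]
      push_cast
      ring
    rw [← hint, ← hint, ← (hN m).indep.integral_fun_comp_mul_comp (hrow 0).aemeasurable
      (hrow 1).aemeasurable (measurable_of_countable _).aestronglyMeasurable
      (measurable_of_countable _).aestronglyMeasurable]
    refine integral_congr_ae (.of_forall fun ω => ?_)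
    simp only [f, ← exp_add]
    congr 1
    rw [← add_mul, ← add_mul, ← add_mul]
    congr 1
    norm_cast
    rw [Fin.sum_univ_two]
    have : ∀ i, ∑ j, γ m i j * (((N m ω i j : ℝ) - n m i * w j) / √(total (n m))) =
        ∑ j, c i j * N m ω i j + -(n m i * b i / √(total (n m))) := by
      intro i
      simp only [b, c]
      rw [Finset.mul_sum, Finset.sum_div, ← Finset.sum_neg_distrib, ← Finset.sum_add_distrib]
      refine Finset.sum_congr rfl fun j _ => ?_
      ring
    rw [this, this]
  · rw [Fin.sum_univ_two]
    congr 2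
    push_cast
    ring

/-! ### Convergence in probability and in distribution -/

section transfer

variable {Ω : ℕ → Type*} [∀ m, MeasurableSpace (Ω m)] {μ : (m : ℕ) → Measure (Ω m)}

open scoped ENNReal

/-- Tightness of real variables whose characteristic functions converge to a function that is
continuous at `0`. -/
theorem exists_forall_measure_abs_gt_le [∀ m, IsProbabilityMeasure (μ m)]
    {X : (m : ℕ) → Ω m → ℝ} (hX : ∀ m, Measurable (X m))
    {f : ℝ → ℂ} (hf : ContinuousAt f 0)
    (h : ∀ s : ℝ, Tendsto (fun m => ∫ ω, Complex.exp ((s * X m ω : ℝ) * Complex.I) ∂μ m) atTop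
      (𝓝 (f s))) {ε : ℝ≥0∞} (hε : 0 < ε) :
    ∃ M : ℝ, ∀ m, μ m {ω | M < |X m ω|} ≤ ε := by
  have hprob : ∀ m, IsProbabilityMeasure ((μ m).map (X m)) := fun m =>
    Measure.isProbabilityMeasure_map (hX m).aemeasurable
  have htight : IsTightMeasureSet (Set.range fun m => (μ m).map (X m)) := by
    refine isTightMeasureSet_of_tendsto_charFun hf fun s => (h s).congr fun m => ?_
    rw [charFun_apply_real, integral_map (hX m).aemeasurable (by fun_prop)]
    push_cast
    rfl
  have h1 := tendsto_measure_norm_gt_of_isTightMeasureSet htight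
  obtain ⟨M, hM⟩ := (h1.eventually (Iic_mem_nhds hε)).exists
  refine ⟨M, fun m => le_trans ?_ hM⟩
  refine le_trans (le_of_eq ?_) (le_iSup₂ (f := fun (ν : Measure ℝ)
    (_ : ν ∈ Set.range fun m => (μ m).map (X m)) => ν {x | M < ‖x‖})
    ((μ m).map (X m)) ⟨m, rfl⟩)
  rw [Measure.map_apply (hX m) (measurableSet_lt measurable_const measurable_norm)]
  rfl

/-- Convergence in probability from uniform convergence on bounded sets: if `h` converges to `0`
along the net of all sample points at which finitely many tight variables are bounded by `M`, for
every `M`, then `h` converges to `0` in probability. -/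
theorem tendsto_measure_of_tendsto_on_bounded {ι : Type*} [Finite ι]
    {X : ι → (m : ℕ) → Ω m → ℝ}
    (hX : ∀ i, ∀ ε : ℝ≥0∞, 0 < ε → ∃ M : ℝ, ∀ m, μ m {ω | M < |X i m ω|} ≤ ε)
    {G : (m : ℕ) → Ω m → Prop} (hG : ∀ m, ∀ᵐ ω ∂μ m, G m ω) {h : (m : ℕ) → Ω m → ℝ}
    (hh : ∀ M : ℝ, Tendsto (fun a : Σ m, Ω m => h a.1 a.2)
      (comap Sigma.fst atTop ⊓ 𝓟 {a | G a.1 a.2 ∧ ∀ i, |X i a.1 a.2| ≤ M}) (𝓝 0))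
    {ε : ℝ} (hε : 0 < ε) : Tendsto (fun m => μ m {ω | ε ≤ |h m ω|}) atTop (𝓝 0) := by
  have := Fintype.ofFinite ι
  rw [ENNReal.tendsto_nhds_zero]
  intro δ hδ
  have hδ' : 0 < δ / (Fintype.card ι + 1) :=
    ENNReal.div_pos hδ.ne' (by finiteness)
  choose M hM using fun i => hX i _ hδ'
  obtain ⟨B, hB⟩ := Finite.exists_le M
  have h1 := (hh B).eventually (Metric.ball_mem_nhds (0 : ℝ) hε)
  rw [eventually_inf_principal, eventually_comap] at h1
  filter_upwards [h1] with m hm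
  have hsub : {ω | ε ≤ |h m ω|} ⊆ {ω | ¬ G m ω} ∪ ⋃ i, {ω | M i < |X i m ω|} := by
    intro ω hω
    by_contra hcon
    simp only [Set.mem_union, Set.mem_iUnion, not_or, not_exists, Set.mem_ofPred_eq, not_not,
      not_lt] at hcon
    have h2 := hm ⟨m, ω⟩ rfl ⟨hcon.1, fun i => (hcon.2 i).trans (hB i)⟩
    rw [dist_zero_right, Real.norm_eq_abs] at h2
    exact absurd hω (not_le.2 h2)
  calc μ m {ω | ε ≤ |h m ω|} ≤ μ m {ω | ¬ G m ω} + μ m (⋃ i, {ω | M i < |X i m ω|}) :=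
        (measure_mono hsub).trans (measure_union_le _ _)
    _ ≤ 0 + ∑ i, μ m {ω | M i < |X i m ω|} := by
        gcongr
        · exact le_of_eq (hG m)
        · exact measure_iUnion_fintype_le _ _
    _ ≤ ∑ _i : ι, δ / (Fintype.card ι + 1) := by
        rw [zero_add]
        exact Finset.sum_le_sum fun i _ => hM i m
    _ = Fintype.card ι * (δ / (Fintype.card ι + 1)) := by simp
    _ ≤ (Fintype.card ι + 1) * (δ / (Fintype.card ι + 1)) := by gcongr; exact le_self_add
    _ = δ := ENNReal.mul_div_cancel (by simp) (by finiteness)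

variable [∀ m, IsProbabilityMeasure (μ m)] {Ω' : Type*} {mΩ' : MeasurableSpace Ω'}
  {μ' : Measure Ω'} [IsProbabilityMeasure μ']

/-- Slutsky's lemma for variables that live on different probability spaces.  It reduces to the
version on a single space by passing to the product of all the spaces. -/
theorem tendstoInDistribution_of_sub_tendsto_zero {X Y : (m : ℕ) → Ω m → ℝ} {Z : Ω' → ℝ}
    (hXZ : TendstoInDistribution X atTop Z μ μ') (hXm : ∀ m, Measurable (X m))
    (hYm : ∀ m, Measurable (Y m))
    (hXY : ∀ ε : ℝ, 0 < ε → Tendsto (fun m => μ m {ω | ε ≤ |Y m ω - X m ω|}) atTop (𝓝 0)) :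
    TendstoInDistribution Y atTop Z μ μ' := by
  let P : Measure ((m : ℕ) → Ω m) := Measure.infinitePi μ
  have hmap : ∀ (X : (m : ℕ) → Ω m → ℝ) (_ : ∀ m, Measurable (X m)) (m : ℕ),
      P.map (fun ω => X m (ω m)) = (μ m).map (X m) := fun X hX m => by
    rw [← (measurePreserving_eval_infinitePi μ m).map_eq,
      Measure.map_map (hX m) (measurable_pi_apply m)]
    rfl
  have hmeas : ∀ (X : (m : ℕ) → Ω m → ℝ) (_ : ∀ m, Measurable (X m)) (m : ℕ),
      Measurable fun ω : (m : ℕ) → Ω m => X m (ω m) := fun X hX m =>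
    (hX m).comp (measurable_pi_apply m)
  have h1 : TendstoInDistribution (fun m (ω : (m : ℕ) → Ω m) => X m (ω m)) atTop Z
      (fun _ => P) μ' := by
    refine ⟨fun m => (hmeas X hXm m).aemeasurable, hXZ.aemeasurable_limit, ?_⟩
    refine hXZ.tendsto.congr fun m => ?_
    exact Subtype.ext (hmap X hXm m).symm
  have h2 := tendstoInDistribution_of_tendstoInMeasure_sub
    (fun m (ω : (m : ℕ) → Ω m) => Y m (ω m)) Z h1
    (by
      rw [tendstoInMeasure_iff_norm]
      intro ε hε
      refine (hXY ε hε).congr fun m => ?_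
      have hms : MeasurableSet {ω | ε ≤ |Y m ω - X m ω|} :=
        measurableSet_le measurable_const ((hYm m).sub (hXm m)).abs
      rw [← (measurePreserving_eval_infinitePi μ m).measure_preimage hms.nullMeasurableSet]
      simp only [Set.preimage, Set.mem_ofPred_eq, Function.eval, Pi.sub_apply, Pi.zero_apply,
        sub_zero, Real.norm_eq_abs, P])
    (fun m => (hmeas Y hYm m).aemeasurable)
  refine ⟨fun m => (hYm m).aemeasurable, hXZ.aemeasurable_limit, ?_⟩
  refine h2.tendsto.congr fun m => ?_
  exact Subtype.ext (hmap Y hYm m)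

/-- Convergence in distribution in Euclidean space from convergence of characteristic functions. -/
theorem tendstoInDistribution_of_tendsto_integral_exp {E : Type*} [NormedAddCommGroup E]
    [InnerProductSpace ℝ E] [FiniteDimensional ℝ E] [MeasurableSpace E] [BorelSpace E]
    {X : (m : ℕ) → Ω m → E} (hX : ∀ m, Measurable (X m)) {ν : Measure E} [IsProbabilityMeasure ν]
    (h : ∀ s : E, Tendsto (fun m => ∫ ω, Complex.exp ((inner ℝ (X m ω) s : ℝ) * Complex.I) ∂μ m)
      atTop (𝓝 (charFun ν s))) :
    TendstoInDistribution X atTop (fun x : E => x) μ ν := by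
  refine ⟨fun m => (hX m).aemeasurable, aemeasurable_id, ?_⟩
  refine ProbabilityMeasure.tendsto_iff_tendsto_charFun.2 fun s => ?_
  simp only [ProbabilityMeasure.coe_mk, Measure.map_id']
  refine (h s).congr fun m => ?_
  rw [charFun_apply, integral_map (hX m).aemeasurable (by fun_prop)]

end transfer

/-- The squared norm of a standard Gaussian vector is chi-squared, the dimension of the space being
the number of degrees of freedom. -/
theorem map_norm_sq_stdGaussian {E : Type*} [NormedAddCommGroup E] [InnerProductSpace ℝ E]
    [FiniteDimensional ℝ E] [MeasurableSpace E] [BorelSpace E] {d : ℕ}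
    (hd : Module.finrank ℝ E = d) :
    (stdGaussian E).map (fun x => ‖x‖ ^ 2) = chiSquared d := by
  subst hd
  rw [stdGaussian, Measure.map_map (by fun_prop) (by fun_prop), chiSquared]
  congr 1
  funext z
  have h := (stdOrthonormalBasis ℝ E).sum_sq_norm_inner_right (∑ i, z i • stdOrthonormalBasis ℝ E i)
  rw [Function.comp_apply, ← h]
  refine Finset.sum_congr rfl fun i _ => ?_
  rw [Orthonormal.inner_right_fintype (stdOrthonormalBasis ℝ E).orthonormal, Real.norm_eq_abs,
    sq_abs]

/-! ### Limit distribution of the block scores -/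

section limit

variable {K : ℕ} {n : ℕ → Fin 2 → ℕ} {ν : Fin 2 → ℝ}
  {Ω : ℕ → Type*} [∀ m, MeasurableSpace (Ω m)]
  {μ : (m : ℕ) → Measure (Ω m)} [∀ m, IsProbabilityMeasure (μ m)]
  {N : (m : ℕ) → Ω m → Fin 2 → Fin (K + 1) → ℕ} {w : Fin (K + 1) → ℝ}

/-- The standardized deviations of the counts are bounded in probability. -/
theorem exists_forall_measure_abs_dev_gt_le
    (ht : Tendsto (fun m => total (n m)) atTop atTop)
    (hnν : ∀ i, Tendsto (fun m => (n m i : ℝ) / total (n m)) atTop (𝓝 (ν i)))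
    (hw : ∑ j, w j = 1) (hN : ∀ m, IsProductMultinomial (μ m) (n m) (fun _ => w) (N m))
    (i : Fin 2) (j : Fin (K + 1)) {ε : ENNReal} (hε : 0 < ε) :
    ∃ M : ℝ, ∀ m, μ m {ω | M < |((N m ω i j : ℝ) - n m i * w j) / √(total (n m))|} ≤ ε := by
  classical
  refine exists_forall_measure_abs_gt_le
    (X := fun m ω => ((N m ω i j : ℝ) - n m i * w j) / √(total (n m)))
    (f := fun s => Complex.exp ((-(∑ i', ν i' * (∑ j', w j' *
      (s * if i' = i ∧ j' = j then 1 else 0) ^ 2 -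
        (∑ j', w j' * (s * if i' = i ∧ j' = j then 1 else 0)) ^ 2)) / 2 : ℝ) : ℂ)) (fun m => ?_)
    ?_ (fun s => ?_) hε
  · exact (measurable_of_countable fun k : Fin 2 → Fin (K + 1) → ℕ =>
      ((k i j : ℝ) - n m i * w j) / √(total (n m))).comp (hN m).measurable
  · fun_prop
  · refine (tendsto_integral_exp_dev ht hnν hw hN
      (γ := fun _ i' j' => s * if i' = i ∧ j' = j then 1 else 0)
      (fun i j => tendsto_const_nhds)).congr fun m => ?_
    refine integral_congr_ae (.of_forall fun ω => ?_)
    beta_reduce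
    congr 3
    rw [Finset.sum_eq_single i, Finset.sum_eq_single j]
    · simp
    · intro j' _ hj'; simp [hj']
    · simp
    · intro i' _ hi'; simp [hi']
    · simp

theorem tendstoInDistribution_of_map_eq {X : (m : ℕ) → Ω m → ℝ} {Ω' : Type*}
    {mΩ' : MeasurableSpace Ω'} {μ' : Measure Ω'} [IsProbabilityMeasure μ'] {Z : Ω' → ℝ}
    (h : TendstoInDistribution X atTop Z μ μ') {ρ : Measure ℝ} [IsProbabilityMeasure ρ]
    (hρ : μ'.map Z = ρ) : TendstoInDistribution X atTop (fun x : ℝ => x) μ ρ := by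
  refine ⟨h.forall_aemeasurable, aemeasurable_id, ?_⟩
  refine h.tendsto.trans_eq (congrArg 𝓝 (Subtype.ext ?_))
  exact hρ.trans Measure.map_id'.symm

/-- Linear forms in the block scores are linear forms in the deviations of the counts. -/
theorem sum_mul_blockScore {ι β : Type*} [Fintype ι] [Fintype β] [DecidableEq β] (blk : ι → β)
    (n : Fin 2 → ℝ) (N : Fin 2 → ι → ℝ) (w : ι → ℝ) (σ : β → ℝ) :
    ∑ b, σ b * blockScore blk n N w b =
      ∑ i, ∑ j, (![√(n 0 / (n 0 + n 1) * (n 1 / (n 0 + n 1))) / (n 0 / (n 0 + n 1)),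
        -(√(n 0 / (n 0 + n 1) * (n 1 / (n 0 + n 1))) / (n 1 / (n 0 + n 1)))] i * σ (blk j)) *
          ((N i j - n i * w j) / √(n 0 + n 1)) := by
  have hdev : ∀ i b, (blockSum blk (N i) b - n i * blockSum blk w b) / √(n 0 + n 1) =
      blockSum blk (fun j => (N i j - n i * w j) / √(n 0 + n 1)) b := fun i b => by
    simp only [blockSum]
    rw [← Finset.sum_div, Finset.sum_sub_distrib, Finset.mul_sum]
  have hsum : ∀ i, ∑ b, σ b * ((blockSum blk (N i) b - n i * blockSum blk w b) / √(n 0 + n 1)) =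
      ∑ j, σ (blk j) * ((N i j - n i * w j) / √(n 0 + n 1)) := fun i => by
    simp only [hdev]
    simp only [mul_comm (σ _)]
    exact (sum_mul_comp_eq_sum_blockSum_mul blk
      (fun j => (N i j - n i * w j) / √(n 0 + n 1)) σ).symm
  rw [Fin.sum_univ_two]
  simp only [Matrix.cons_val_zero, Matrix.cons_val_one, mul_assoc, ← Finset.mul_sum, ← hsum]
  rw [Finset.mul_sum, Finset.mul_sum, ← Finset.sum_add_distrib]
  refine Finset.sum_congr rfl fun b _ => ?_
  rw [blockScore]
  ring

/-- The weighted sum of squares of the block scores is asymptotically chi-squared: the vector of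
scores divided by the square roots `√w_b` of the block probabilities lies in the orthogonal
complement of the unit vector `(√w_b)_b`, and converges there to a standard Gaussian vector. -/
theorem tendstoInDistribution_sum_blockScore_sq {β : Type*} [Fintype β] [DecidableEq β]
    {blk : Fin (K + 1) → β} (hsurj : Function.Surjective blk) {d : ℕ}
    (hcard : Fintype.card β = d + 1)
    (ht : Tendsto (fun m => total (n m)) atTop atTop) (hν : ∀ i, 0 < ν i)
    (hnν : ∀ i, Tendsto (fun m => (n m i : ℝ) / total (n m)) atTop (𝓝 (ν i)))
    (hνsum : ν 0 + ν 1 = 1) (hwpos : ∀ j, 0 < w j)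
    (hw : ∑ j, w j = 1) (hN : ∀ m, IsProductMultinomial (μ m) (n m) (fun _ => w) (N m)) :
    TendstoInDistribution (fun m ω => ∑ b, blockScore blk (fun i => (n m i : ℝ))
      (fun i j => (N m ω i j : ℝ)) w b ^ 2 / blockSum blk w b) atTop (fun x : ℝ => x) μ
      (chiSquared d) := by
  have hv : ∀ b, 0 < blockSum blk w b := fun b => by
    obtain ⟨j, rfl⟩ := hsurj b
    exact blockSum_pos hwpos j
  let u : EuclideanSpace ℝ β := WithLp.toLp 2 fun b => √(blockSum blk w b)
  have hu : u ≠ 0 := by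
    intro h0
    have h1 := congrArg (fun x : EuclideanSpace ℝ β => x (blk 0)) h0
    simp only [u, PiLp.zero_apply] at h1
    exact (Real.sqrt_pos.2 (hv _)).ne' h1
  let W : Submodule ℝ (EuclideanSpace ℝ β) := (Submodule.span ℝ {u})ᗮ
  have hfin : Module.finrank ℝ W = d := by
    have : Fact (Module.finrank ℝ (EuclideanSpace ℝ β) = d + 1) := ⟨by simp [hcard]⟩
    exact Submodule.finrank_orthogonal_span_singleton hu
  let V : (m : ℕ) → (Fin 2 → Fin (K + 1) → ℕ) → EuclideanSpace ℝ β := fun m k =>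
    WithLp.toLp 2 fun b => blockScore blk (fun i => (n m i : ℝ)) (fun i j => (k i j : ℝ)) w b /
      √(blockSum blk w b)
  have hZ : TendstoInDistribution (fun m ω => W.orthogonalProjectionOnto (V m (N m ω))) atTop
      (fun x : W => x) μ (stdGaussian W) := by
    refine tendstoInDistribution_of_tendsto_integral_exp (fun m => ?_) fun s => ?_
    · exact (measurable_of_countable fun k => W.orthogonalProjectionOnto (V m k)).comp
        (hN m).measurable
    let σ : β → ℝ := fun b => (s : EuclideanSpace ℝ β) b / √(blockSum blk w b)
    have hinner : ∀ m ω, inner ℝ (W.orthogonalProjectionOnto (V m (N m ω))) s =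
        ∑ b, σ b * blockScore blk (fun i => (n m i : ℝ)) (fun i j => (N m ω i j : ℝ)) w b := by
      intro m ω
      rw [Submodule.inner_orthogonalProjectionOnto_eq_of_mem_right, PiLp.inner_apply]
      refine Finset.sum_congr rfl fun b _ => ?_
      simp only [V, σ, RCLike.inner_apply, conj_trivial]
      ring
    have hκ : ∀ i, Tendsto (fun m => ![√((n m 0 : ℝ) / ((n m 0 : ℝ) + n m 1) *
        ((n m 1 : ℝ) / ((n m 0 : ℝ) + n m 1))) / ((n m 0 : ℝ) / ((n m 0 : ℝ) + n m 1)),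
        -(√((n m 0 : ℝ) / ((n m 0 : ℝ) + n m 1) *
        ((n m 1 : ℝ) / ((n m 0 : ℝ) + n m 1))) / ((n m 1 : ℝ) / ((n m 0 : ℝ) + n m 1)))] i) atTop
        (𝓝 (![√(ν 0 * ν 1) / ν 0, -(√(ν 0 * ν 1) / ν 1)] i)) := by
      have hs := ((hnν 0).mul (hnν 1)).sqrt
      intro i
      fin_cases i
      · exact hs.div (hnν 0) (hν 0).ne'
      · exact (hs.div (hnν 1) (hν 1).ne').neg
    have hlim := tendsto_integral_exp_dev ht hnν hw hN
      (fun i j => (hκ i).mul_const (σ (blk j)))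
    refine (hlim.congr fun m => ?_).trans_eq ?_
    · refine integral_congr_ae (.of_forall fun ω => ?_)
      simp only [hinner]
      rw [sum_mul_blockScore]
      rfl
    · have hA : ∑ j, w j * σ (blk j) ^ 2 = ‖s‖ ^ 2 := by
        rw [sum_mul_comp_eq_sum_blockSum_mul blk w fun b => σ b ^ 2, Submodule.coe_norm,
          EuclideanSpace.norm_sq_eq]
        refine Finset.sum_congr rfl fun b _ => ?_
        have := (hv b).ne'
        simp only [σ, div_pow, Real.sq_sqrt (hv b).le, Real.norm_eq_abs, sq_abs]
        field_simp
      have hB : ∑ j, w j * σ (blk j) = 0 := by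
        rw [sum_mul_comp_eq_sum_blockSum_mul blk w σ]
        have horth : inner ℝ u (s : EuclideanSpace ℝ β) = 0 :=
          Submodule.mem_orthogonal_singleton_iff_inner_right.1 s.2
        rw [PiLp.inner_apply] at horth
        rw [← horth]
        refine Finset.sum_congr rfl fun b _ => ?_
        have h1 : √(blockSum blk w b) * √(blockSum blk w b) = blockSum blk w b :=
          Real.mul_self_sqrt (hv b).le
        have h2 : √(blockSum blk w b) ≠ 0 := (Real.sqrt_pos.2 (hv b)).ne'
        simp only [u, σ, RCLike.inner_apply, conj_trivial]
        nth_rw 1 [← h1]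
        field_simp
      -- The two samples contribute the fractions `ν 1` and `ν 0` of the variance `‖s‖ ^ 2`.
      have h0 := hν 0
      have h1 := hν 1
      rw [charFun_stdGaussian, Fin.sum_univ_two]
      simp only [Matrix.cons_val_zero, Matrix.cons_val_one, mul_pow, mul_left_comm (w _),
        ← Finset.mul_sum, hA, hB, neg_sq, div_pow, Real.sq_sqrt (mul_pos h0 h1).le]
      have : ν 0 * (ν 0 * ν 1 / ν 0 ^ 2 * ‖s‖ ^ 2 - ν 0 * ν 1 / ν 0 ^ 2 * 0 ^ 2) +
          ν 1 * (ν 0 * ν 1 / ν 1 ^ 2 * ‖s‖ ^ 2 - ν 0 * ν 1 / ν 1 ^ 2 * 0 ^ 2) = ‖s‖ ^ 2 := by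
        have h2 : ν 0 = 1 - ν 1 := by linarith
        field_simp
        rw [h2]
        ring
      rw [this]
      push_cast
      rfl
  have hsq := hZ.continuous_comp (g := fun x : W => ‖x‖ ^ 2) (by fun_prop)
  have hsq' := tendstoInDistribution_of_map_eq hsq (map_norm_sq_stdGaussian hfin)
  refine hsq'.congr (fun m => ?_) .rfl
  have hrow : ∀ᵐ ω ∂μ m, ∀ i, ∑ j, N m ω i j = n m i :=
    ae_all_iff.2 fun i => ae_sum_eq_of_multinomial ((hN m).law i)
  filter_upwards [hrow] with ω hω
  have hmem : V m (N m ω) ∈ W := by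
    refine Submodule.mem_orthogonal_singleton_iff_inner_right.2 ?_
    rw [PiLp.inner_apply]
    rw [← sum_blockScore blk (n := fun i => (n m i : ℝ)) (N := fun i j => (N m ω i j : ℝ))
      (fun i => by exact_mod_cast hω i) hw]
    refine Finset.sum_congr rfl fun b _ => ?_
    have h2 : √(blockSum blk w b) ≠ 0 := (Real.sqrt_pos.2 (hv b)).ne'
    simp only [u, V, RCLike.inner_apply, conj_trivial]
    field_simp
  simp only [Function.comp_apply]
  rw [Submodule.norm_orthogonalProjectionOnto_apply W hmem, EuclideanSpace.norm_sq_eq]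
  refine Finset.sum_congr rfl fun b _ => ?_
  simp only [V, Real.norm_eq_abs, sq_abs, div_pow, Real.sq_sqrt (hv b).le]

end limit

end LoglinearTest

theorem mainTheorem2 {K : ℕ} (S : Finset (Fin K))
    (φ : ℝ → ℝ) (hφ : IsDivergenceFunction φ)
    (θ₀ : Param K) (hH₀ : (matR K).mulVec θ₀ = 0)
    (n : ℕ → Fin 2 → ℕ) (hn : ∀ i, Tendsto (fun m => n m i) atTop atTop)
    (ν : Fin 2 → ℝ) (hν : ∀ i, 0 < ν i)
    (hnν : ∀ i, Tendsto (fun m => (n m i : ℝ) / total (n m)) atTop (𝓝 (ν i)))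
    {Ω : ℕ → Type*} [∀ m, MeasurableSpace (Ω m)]
    (μ : (m : ℕ) → Measure (Ω m)) [∀ m, IsProbabilityMeasure (μ m)]
    (N : (m : ℕ) → Ω m → Fin 2 → Fin (K + 1) → ℕ)
    (hN : ∀ m, IsProductMultinomial (μ m) (n m) (condProb θ₀) (N m))
    (θhat θhatS : ℕ → (Fin 2 → Fin (K + 1) → ℕ) → Param K)
    (hθhat : ∀ m, IsMLEstimator (n m) (nullSpace K) (θhat m))
    (hθhatS : ∀ m, IsMLEstimator (n m) (restrictedSpace S) (θhatS m)) :
    (∀ ε : ℝ, 0 < ε →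
      Tendsto (fun m => μ m {ω | ε ≤ |testS φ (n m) (θhatS m) (θhat m) (N m ω) -
        testT φ (n m) (θhatS m) (θhat m) (N m ω)|}) atTop (𝓝 0)) ∧
      TendstoInDistribution (fun m ω => testS φ (n m) (θhatS m) (θhat m) (N m ω)) atTop
        (fun x : ℝ => x) μ (chiSquared (K - S.card)) ∧
      TendstoInDistribution (fun m ω => testT φ (n m) (θhatS m) (θhat m) (N m ω)) atTop
        (fun x : ℝ => x) μ (chiSquared (K - S.card)) := by
  obtain ⟨blk, hsurj, hblk⟩ := exists_surjective_blockMap S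
  set w : Fin (K + 1) → ℝ := condProb θ₀ 1 with hwdef
  have hcond : condProb θ₀ = fun _ => w := by
    funext i j
    exact condProb_eq_of_mem_nullSpace (K := K) hH₀ i j
  have hw : ∑ j, w j = 1 := sum_condProb θ₀ 1
  have hwpos : ∀ j, 0 < w j := condProb_pos θ₀ 1
  have hN' : ∀ m, IsProductMultinomial (μ m) (n m) (fun _ => w) (N m) := fun m => hcond ▸ hN m
  have ht : Tendsto (fun m => total (n m)) atTop atTop :=
    (tendsto_natCast_atTop_atTop.comp (hn 0)).atTop_add_nonneg fun m => Nat.cast_nonneg (n m 1)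
  have hνsum : ν 0 + ν 1 = 1 := by
    refine tendsto_nhds_unique ((hnν 0).add (hnν 1)) (tendsto_const_nhds.congr' ?_)
    filter_upwards [ht.eventually_gt_atTop 0] with m hm
    rw [← add_div]
    exact (div_self hm.ne').symm
  let Q : (m : ℕ) → (Fin 2 → Fin (K + 1) → ℕ) → ℝ := fun m k =>
    ∑ b, blockScore blk (fun i => (n m i : ℝ)) (fun i j => (k i j : ℝ)) w b ^ 2 /
      blockSum blk w b
  have hQ : TendstoInDistribution (fun m ω => Q m (N m ω)) atTop (fun x : ℝ => x) μ
      (chiSquared (K - S.card)) :=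
    tendstoInDistribution_sum_blockScore_sq hsurj (by simp) ht hν hnν hνsum hwpos hw hN'
  let G : (m : ℕ) → Ω m → Prop := fun m ω => ∀ i, ∑ j, N m ω i j = n m i
  have hG : ∀ m, ∀ᵐ ω ∂μ m, G m ω := fun m =>
    ae_all_iff.2 fun i => ae_sum_eq_of_multinomial ((hN m).law i)
  let X : Fin 2 × Fin (K + 1) → (m : ℕ) → Ω m → ℝ := fun p m ω =>
    ((N m ω p.1 p.2 : ℝ) - n m p.1 * w p.2) / √(total (n m))
  have hX : ∀ p, ∀ ε : ENNReal, 0 < ε → ∃ M : ℝ, ∀ m, μ m {ω | M < |X p m ω|} ≤ ε :=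
    fun p ε hε => exists_forall_measure_abs_dev_gt_le ht hnν hw hN' p.1 p.2 hε
  -- The net of all sample points at which the row sums are right and the standardized deviations
  -- are bounded by `M`, directed by the index of the experiment.
  have hreg : ∀ M : ℝ, IsRegularTable
      (comap Sigma.fst atTop ⊓ 𝓟 {a : Σ m, Ω m | G a.1 a.2 ∧ ∀ p, |X p a.1 a.2| ≤ M})
      (fun a i => (n a.1 i : ℝ)) (fun a i j => (N a.1 a.2 i j : ℝ)) w ν := by
    intro M
    have hfst : Tendsto (Sigma.fst : (Σ m, Ω m) → ℕ)
        (comap Sigma.fst atTop ⊓ 𝓟 {a : Σ m, Ω m | G a.1 a.2 ∧ ∀ p, |X p a.1 a.2| ≤ M}) atTop :=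
      tendsto_comap.mono_left inf_le_left
    have hev : ∀ᶠ a in comap Sigma.fst atTop ⊓
        𝓟 {a : Σ m, Ω m | G a.1 a.2 ∧ ∀ p, |X p a.1 a.2| ≤ M},
        G a.1 a.2 ∧ ∀ p, |X p a.1 a.2| ≤ M := mem_inf_of_right (mem_principal_self _)
    refine ⟨ht.comp hfst, hν, fun i => (hnν i).comp hfst, hwpos, fun i j => ?_, ?_⟩
    · refine Asymptotics.IsBigO.of_bound M (hev.mono fun a ha => ?_)
      rw [Real.norm_eq_abs, norm_one, mul_one]
      exact ha.2 (i, j)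
    · exact hev.mono fun a ha i => by exact_mod_cast ha.1 i
  have hlim := fun M : ℝ => tendsto_testS_testT_sub hsurj hblk hφ (hreg M)
    (fun a => hθhat a.1) (fun a => hθhatS a.1)
  have hmeas : ∀ f : ℕ → (Fin 2 → Fin (K + 1) → ℕ) → ℝ, ∀ m,
      Measurable fun ω => f m (N m ω) := fun f m =>
    (measurable_of_countable (f m)).comp (hN m).measurable
  refine ⟨fun ε hε => ?_, ?_, ?_⟩
  · refine tendsto_measure_of_tendsto_on_bounded hX hG (fun M => ?_) hε
    simpa using (hlim M).1.sub (hlim M).2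
  · exact tendstoInDistribution_of_sub_tendsto_zero hQ (hmeas Q)
      (hmeas fun m => testS φ (n m) (θhatS m) (θhat m))
      fun ε hε => tendsto_measure_of_tendsto_on_bounded hX hG (fun M => (hlim M).1) hε
  · exact tendstoInDistribution_of_sub_tendsto_zero hQ (hmeas Q)
      (hmeas fun m => testT φ (n m) (θhatS m) (θhat m))
      fun ε hε => tendsto_measure_of_tendsto_on_bounded hX hG (fun M => (hlim M).2) hε
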